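/- **Setting.** Let $(\Omega,d)$ be a compact metric space with a minimal continuous flow $(t,\omega)\mapsto\omega\cdot t$ of $\mathbb R$ (its only nonempty compact invariant subset is $\Omega$), let $m\in\mathbb N$, and let $\mathbb R^m$ carry the maximum norm and the componentwise order. Let $BC$ be the Banach space of bounded continuous functions $x:(-\infty,0]\to\mathbb R^m$ with the norm $\|x\|_\infty=\sup_{s\le0}\|x(s)\|$, let $B_r=\{x\in BC:\|x\|_\infty\le r\}$, and let $$\mathsf d(x,y)=\sum_{n\ge1}2^{-n}\frac{\|x-y\|_n}{1+\|x-y\|_n},\qquad \|x\|_n=\sup_{s\in[-n,0]}\|x(s)\|,$$ be the metric of the compact-open topology. Write $x_t(s)=x(t+s)$ for $s\le 0$. Let $A=\mathrm{diag}(a_1,\dots,a_m)$ with all $a_i<0$, and for $x,y\in BC$ let $$x\le_A y\iff x\le y\ \text{ and }\ y(t)-x(t)\ge e^{A(t-s)}(y(s)-x(s))\ \text{ for } s\le t\le 0 .$$ Let $D:\Omega\times BC\to\mathbb R^m$ satisfy * (D1) $D(\omega,\cdot)$ is linear and continuous for $\|\cdot\|_\infty$, and $\omega\mapsto D(\omega,\cdot)\in\mathcal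 L(BC,\mathbb R^m)$ is continuous; * (D2) for each $r>0$, $D$ is continuous on $\Omega\times B_r$ when $B_r$ carries the compact-open topology; * (D3) writing $D(\omega,x)=\int_{-\infty}^0[d\mu(\omega)(s)]\,x(s)$ with the (unique) matrix $\mu(\omega)$ of finite signed Borel measures on $(-\infty,0]$, one has $\mu(\omega)(\{0\})=I$ for all $\omega$; * (D4) $D$ is stable: there is a continuous $c:[0,\infty)\to\mathbb R$ with $c(t)\to0$ as $t\to\infty$ such that, whenever $D(\omega,\varphi)=0$, the solution $x$ of $D(\omega\cdot t,x_t)=0$ $(t\ge0)$, $x_0=\varphi$, satisfies $\|x(t)\|\le c(t)\|\varphi\|_\infty$ for all $t\ge0$. Put $\widehat D_2(\omega,x)(s)=D(\omega\cdot s,x_s)$ for $s\le0$, $\widehat D(\omega,x)=(\omega,\widehat D_2(\omega,x))$, and $(\omega,x)\le_{D,A}(\omega,y)\iff\widehat D_2(\omega,x)\le_A\widehat D_2(\omega,y)$. Let $G:\Omega\times BC\to\mathbb R^m$ satisfy * (N1) $G$ is continuous for $\|\cdot\|_\infty$ on $BC$ and, for each $r>0$, Lipschitz in its second variable on $\Omega\times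 B_r$ (uniformly in $\omega$); * (N2) for each $r>0$, $G$ is continuous on $\Omega\times B_r$ when $B_r$ carries the compact-open topology; * (N3) if $(\omega,x)\le_{D,A}(\omega,y)$, then $G(\omega,y)-G(\omega,x)\ge A(D(\omega,y)-D(\omega,x))$. **Conclusion.** $\widehat D$ is a bijection of $\Omega\times BC$ onto itself, and $F=G\circ\widehat D^{-1}$ satisfies * (F1) $F$ is continuous for $\|\cdot\|_\infty$ on $BC$ and, for each $r>0$, Lipschitz in its second variable on $\Omega\times B_r$ (uniformly in $\omega$); * (F2) for each $r>0$, $F$ is continuous on $\Omega\times B_r$ when $B_r$ carries the compact-open topology; * (F3) if $x\le_A y$, then $F(\omega,y)-F(\omega,x)\ge A(y(0)-x(0))$ for each $\omega\in\Omega$. If, in addition, $G$ satisfies * (N4) whenever $(\omega,x)$ and $(\omega,y)$ admit backward orbits for the semiflow $(t,\omega,x)\mapsto(\omega\cdot t,z_t)$ given by the solutions of $\frac{d}{dt}D(\omega\cdot t,z_t)=G(\omega\cdot t,z_t)$, $z_0=x$, and $(\omega,x)\le_{D,A}(\omega,y)$, and $J\subset\{1,\dots,m\}$ is such that $\widehat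 D_2(\omega,x)_i=\widehat D_2(\omega,y)_i$ for $i\notin J$ and $\widehat D_2(\omega,x)_i(s)<\widehat D_2(\omega,y)_i(s)$ for $i\in J$, $s\le0$, then $G_i(\omega,y)-G_i(\omega,x)-[A(D(\omega,y)-D(\omega,x))]_i>0$ for each $i\in J$; * (N5) for each $k\in\mathbb N$, $B_k$ is uniformly stable for $\le_{D,A}$: for each $\varepsilon>0$ there is $\delta>0$ such that, for all $\omega\in\Omega$ and $x,y\in B_k$ with $\mathsf d(x,y)<\delta$ and $(\omega,x)\le_{D,A}(\omega,y)$ or $(\omega,y)\le_{D,A}(\omega,x)$, the solutions $z,w$ of the neutral equation over $\omega$ with $z_0=x$, $w_0=y$ are defined on $[0,\infty)$ and $\mathsf d(z_t,w_t)<\varepsilon$ for all $t\ge0$; then $F$ also satisfies * (F4) whenever $(\omega,x)$ and $(\omega,y)$ admit backward orbits for the semiflow given by the solutions of $z'(t)=F(\omega\cdot t,z_t)$, and $x\le_A y$, and $J\subset\{1,\dots,m\}$ is such that $x_i=y_i$ for $i\notin J$ and $x_i(s)<y_i(s)$ for $i\in J$, $s\le0$, then $F_i(\omega,y)-F_i(\omega,x)-[A(y(0)-x(0))]_i>0$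 for each $i\in J$; * (F5) for each $k\in\mathbb N$, $B_k$ is uniformly stable for $\le_A$: for each $\varepsilon>0$ there is $\delta>0$ such that, for all $\omega\in\Omega$ and $x,y\in B_k$ with $\mathsf d(x,y)<\delta$ and $x\le_A y$ or $y\le_A x$, the solutions $z,w$ of $z'(t)=F(\omega\cdot t,z_t)$ over $\omega$ with $z_0=x$, $w_0=y$ are defined on $[0,\infty)$ and $\mathsf d(z_t,w_t)<\varepsilon$ for all $t\ge0$. Here a backward orbit of $(\omega,x)$ is a map $\psi:(-\infty,0]\to\Omega\times BC$, continuous for the compact-open topology on $BC$, with $\psi(0)=(\omega,x)$ and such that for $s\le0$ and $0\le t\le -s$ the semiflow takes $\psi(s)$ to $\psi(s+t)$ in time $t$. -/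

import Mathlib

open Set Filter Topology MeasureTheory

namespace NeutralFDE

noncomputable section

/-- `ℝ^m` with the maximum norm. -/
abbrev E (m : ℕ) : Type := Fin m → ℝ

/-- `BC`: bounded continuous functions `(-∞, 0] → ℝ^m` with the supremum norm. -/
abbrev BC (m : ℕ) : Type := BoundedContinuousFunction (Iic (0 : ℝ)) (E m)

/-- The endpoint `0` of `(-∞, 0]`. -/
def origin : Iic (0 : ℝ) := ⟨0, mem_Iic.2 le_rfl⟩

/-- `B_r`: the closed ball of radius `r` about `0` in `BC`. -/
def ball (m : ℕ) (r : ℝ) : Set (BC m) := {x | ‖x‖ ≤ r}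

/-- `‖x‖_n = sup_{s ∈ [-n, 0]} ‖x s‖`. -/
def seminormOn {m : ℕ} (n : ℕ) (x : BC m) : ℝ :=
  ⨆ s : {s : Iic (0 : ℝ) // -(n : ℝ) ≤ (s : ℝ)}, ‖x s.1‖

/-- The metric of the compact-open topology,
`d(x, y) = ∑_{n ≥ 1} 2^{-n} ‖x - y‖_n / (1 + ‖x - y‖_n)`. -/
def coDist {m : ℕ} (x y : BC m) : ℝ :=
  ∑' n : ℕ, (1 / 2 : ℝ) ^ (n + 1) *
    (seminormOn (n + 1) (x - y) / (1 + seminormOn (n + 1) (x - y)))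

/-- The translate `x_s` of `x ∈ BC` for `s ≤ 0`: `x_s(r) = x(s + r)`. -/
def shift {m : ℕ} (x : BC m) (s : Iic (0 : ℝ)) : BC m :=
  x.compContinuous
    ⟨fun r => ⟨(s : ℝ) + (r : ℝ), mem_Iic.2 (add_nonpos (mem_Iic.1 s.2) (mem_Iic.1 r.2))⟩,
      (continuous_const.add continuous_subtype_val).subtype_mk _⟩

open Classical in
/-- The segment `z_t ∈ BC`, `z_t(s) = z(t + s)` for `s ≤ 0`, of a function `z` that is continuous
and bounded on `(-∞, t]` (and the zero function for other `z`). -/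
def segment {m : ℕ} (z : ℝ → E m) (t : ℝ) : BC m :=
  if h : Continuous (fun s : Iic (0 : ℝ) => z (t + s)) ∧
      ∃ C : ℝ, ∀ s : Iic (0 : ℝ), ‖z (t + s)‖ ≤ C then
    BoundedContinuousFunction.ofNormedAddCommGroup (fun s : Iic (0 : ℝ) => z (t + s)) h.1
      h.2.choose h.2.choose_spec
  else 0

theorem segment_apply {m : ℕ} {z : ℝ → E m} {t : ℝ}
    (hc : Continuous (fun s : Iic (0 : ℝ) => z (t + s)))
    (hb : ∃ C : ℝ, ∀ s : Iic (0 : ℝ), ‖z (t + s)‖ ≤ C) (s : Iic (0 : ℝ)) :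
    segment z t s = z (t + s) := by
  rw [segment, dif_pos ⟨hc, hb⟩]
  rfl

/-! ### Flows on the base -/

section Base

variable {Ω : Type*} [TopologicalSpace Ω]

/-- The flow is minimal: its only nonempty compact invariant set is the whole space. -/
def IsMinimalFlow (φ : Flow ℝ Ω) : Prop :=
  ∀ S : Set Ω, IsCompact S → S.Nonempty → (∀ t : ℝ, φ t '' S = S) → S = univ

/-! ### Regularity conditions -/

/-- `F` is continuous on `Ω × BC` for the norm of `BC`, and Lipschitz continuous in its second
variable on `Ω × B_r`, for each `r > 0`. -/
def NormRegular {m : ℕ} (F : Ω × BC m → E m) : Prop :=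
  Continuous F ∧
    ∀ r : ℝ, 0 < r → ∃ L : NNReal, ∀ ω : Ω, LipschitzOnWith L (fun x => F (ω, x)) (ball m r)

/-- For each `r > 0`, `F` is continuous on `Ω × B_r` for the compact-open topology on `B_r`. -/
def CompactOpenRegular {m : ℕ} (F : Ω × BC m → E m) : Prop :=
  ∀ r : ℝ, 0 < r → ∀ (ω' : ℕ → Ω) (ω : Ω) (x' : ℕ → BC m) (x : BC m),
    (∀ n, x' n ∈ ball m r) → x ∈ ball m r →
    Tendsto ω' atTop (𝓝 ω) → Tendsto (fun n => coDist (x' n) x) atTop (𝓝 0) →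
    Tendsto (fun n => F (ω' n, x' n)) atTop (𝓝 (F (ω, x)))

/-! ### The operator `D` -/

/-- The matrix `μ = [μ_ij]` of (finite) signed Borel measures on `(-∞, 0]` represents `L`, i.e.
`L x = ∫ [dμ(s)] x(s)`. -/
def Represents {m : ℕ} (L : BC m →L[ℝ] E m)
    (μ : Matrix (Fin m) (Fin m) (SignedMeasure (Iic (0 : ℝ)))) : Prop :=
  ∀ (x : BC m) (i : Fin m), L x i = ∑ j, ∫ᵛ s, x s j ∂<•(μ i j)

open Classical in
/-- The matrix `B = μ({0})`, where `μ` is the matrix of signed Borel measures representing `L`.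
The representing matrix is unique; it exists whenever `L` is continuous on the balls `B_r` for
the compact-open topology. -/
def massAtZero {m : ℕ} (L : BC m →L[ℝ] E m) : Matrix (Fin m) (Fin m) ℝ :=
  if h : ∃ μ, Represents L μ then Matrix.of (fun i j => h.choose i j {origin}) else 0

/-- `D` is stable: the solutions of `D(ω·t, x_t) = 0`, `t ≥ 0`, `x_0 = ϕ`, with `D(ω, ϕ) = 0`,
satisfy `‖x(t)‖ ≤ c(t) ‖ϕ‖` with `c` continuous and tending to `0`. -/
def StableOperator {m : ℕ} (φ : Flow ℝ Ω) (D : Ω → BC m →L[ℝ] E m) : Prop :=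
  ∃ c : ℝ → ℝ, ContinuousOn c (Ici 0) ∧ Tendsto c atTop (𝓝 0) ∧
    ∀ (ω : Ω) (ϕ : BC m), D ω ϕ = 0 →
      ∀ x : ℝ → E m, Continuous x → (∀ s : Iic (0 : ℝ), x s = ϕ s) →
        (∀ t : ℝ, 0 ≤ t → D (φ t ω) (segment x t) = 0) →
        ∀ t : ℝ, 0 ≤ t → ‖x t‖ ≤ c t * ‖ϕ‖

/-- `D̂₂(ω, x) : (-∞, 0] → ℝ^m`, `s ↦ D(ω·s, x_s)`. -/
def dHat₂ {m : ℕ} (φ : Flow ℝ Ω) (D : Ω → BC m →L[ℝ] E m) (ω : Ω) (x : BC m) :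
    Iic (0 : ℝ) → E m :=
  fun s => D (φ (s : ℝ) ω) (shift x s)

/-! ### Exponential orders -/

/-- The exponential order `x ≤_A y` for `A = diag(a_1, …, a_m)`: `x ≤ y` and
`y(t) - x(t) ≥ e^{A(t-s)} (y(s) - x(s))` for `s ≤ t ≤ 0`. -/
def ExpLE {m : ℕ} (a : Fin m → ℝ) (x y : Iic (0 : ℝ) → E m) : Prop :=
  x ≤ y ∧ ∀ s t : Iic (0 : ℝ), s ≤ t → ∀ i : Fin m,
    Real.exp (a i * ((t : ℝ) - (s : ℝ))) * (y s i - x s i) ≤ y t i - x t i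

/-- The transformed exponential order `(ω, x) ≤_{D,A} (ω, y)`. -/
def TransformedLE {m : ℕ} (φ : Flow ℝ Ω) (D : Ω → BC m →L[ℝ] E m) (a : Fin m → ℝ)
    (ω : Ω) (x y : BC m) : Prop :=
  ExpLE a (dHat₂ φ D ω x) (dHat₂ φ D ω y)

/-- On the components in `J` the function `x` is strictly below `y` at every point; on the other
components the two functions coincide. -/
def SeparatedOn {m : ℕ} (J : Set (Fin m)) (x y : Iic (0 : ℝ) → E m) : Prop :=
  (∀ i ∉ J, ∀ s, x s i = y s i) ∧ ∀ i ∈ J, ∀ s, x s i < y s i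

/-! ### Solutions, backward orbits and uniform stability -/

/-- `z` solves `z'(t) = F(ω·t, z_t)` on `[0, T]` with `z_0 = x`. -/
def IsFDESol {m : ℕ} (φ : Flow ℝ Ω) (F : Ω × BC m → E m)
    (T : ℝ) (ω : Ω) (x : BC m) (z : ℝ → E m) : Prop :=
  ContinuousOn z (Iic T) ∧ (∀ s : Iic (0 : ℝ), z s = x s) ∧
    ∀ t ∈ Icc 0 T, HasDerivWithinAt z (F (φ t ω, segment z t)) (Icc 0 T) t

/-- `z` solves `(d/dt) D(ω·t, z_t) = G(ω·t, z_t)` on `[0, T]` with `z_0 = x`. -/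
def IsNFDESol {m : ℕ} (φ : Flow ℝ Ω) (D : Ω → BC m →L[ℝ] E m) (G : Ω × BC m → E m)
    (T : ℝ) (ω : Ω) (x : BC m) (z : ℝ → E m) : Prop :=
  ContinuousOn z (Iic T) ∧ (∀ s : Iic (0 : ℝ), z s = x s) ∧
    ∀ t ∈ Icc 0 T, HasDerivWithinAt (fun τ => D (φ τ ω) (segment z τ))
      (G (φ t ω, segment z t)) (Icc 0 T) t

/-- Given a notion `Sol T ω x z` of solution on `[0, T]` with initial datum `x`: the relation
`y = u(t, ω, x)`, i.e. a solution on `[0, t]` starting from `x` satisfies `z_t = y`. -/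
def Reaches {m : ℕ} (Sol : ℝ → Ω → BC m → (ℝ → E m) → Prop)
    (t : ℝ) (ω : Ω) (x y : BC m) : Prop :=
  ∃ z : ℝ → E m, Sol t ω x z ∧ segment z t = y

/-- `(ω, x)` admits a backward orbit `ψ : (-∞, 0] → Ω × BC` for the skew-product semiflow
`(t, ω, x) ↦ (ω·t, u(t, ω, x))`; continuity of `ψ` is for the compact-open topology on `BC`. -/
def HasBackwardOrbit {m : ℕ} (φ : Flow ℝ Ω) (Sol : ℝ → Ω → BC m → (ℝ → E m) → Prop)
    (ω : Ω) (x : BC m) : Prop :=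
  ∃ ψ : Iic (0 : ℝ) → Ω × BC m,
    Continuous (fun s => (ψ s).1) ∧
    (∀ s₀, Tendsto (fun s => coDist (ψ s).2 (ψ s₀).2) (𝓝 s₀) (𝓝 0)) ∧
    ψ origin = (ω, x) ∧
    ∀ s s' : Iic (0 : ℝ), s ≤ s' →
      (ψ s').1 = φ ((s' : ℝ) - (s : ℝ)) (ψ s).1 ∧
      Reaches Sol ((s' : ℝ) - (s : ℝ)) (ψ s).1 (ψ s).2 (ψ s').2

/-- `K ⊆ BC` is uniformly stable for the (fibrewise) order `R ω x y`: for every `ε > 0` there is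
`δ > 0` such that, for all `ω` and all `x, y ∈ K` comparable over `ω` with `d(x, y) < δ`, the
solutions `u(t, ω, x)`, `u(t, ω, y)` are defined and satisfy
`d(u(t, ω, x), u(t, ω, y)) < ε` for all `t ≥ 0`. -/
def UniformlyStable {m : ℕ} (Sol : ℝ → Ω → BC m → (ℝ → E m) → Prop)
    (R : Ω → BC m → BC m → Prop) (K : Set (BC m)) : Prop :=
  ∀ ε : ℝ, 0 < ε → ∃ δ : ℝ, 0 < δ ∧ ∀ (ω : Ω), ∀ x ∈ K, ∀ y ∈ K, coDist x y < δ →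
    (R ω x y ∨ R ω y x) →
    (∃ z : ℝ → E m, ∀ T : ℝ, 0 ≤ T → Sol T ω x z) ∧
    (∃ w : ℝ → E m, ∀ T : ℝ, 0 ≤ T → Sol T ω y w) ∧
    ∀ z w : ℝ → E m, (∀ T : ℝ, 0 ≤ T → Sol T ω x z) → (∀ T : ℝ, 0 ≤ T → Sol T ω y w) →
      ∀ t : ℝ, 0 ≤ t → coDist (segment z t) (segment w t) < ε

/-! ### Order conditions on the functional differential equation -/

/-- Quasimonotonicity of `F`: `x ≤_A y` implies `F(ω, y) - F(ω, x) ≥ A (y(0) - x(0))`. -/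
def Quasimonotone {m : ℕ} (a : Fin m → ℝ) (F : Ω × BC m → E m) : Prop :=
  ∀ (ω : Ω) (x y : BC m), ExpLE a x y →
    (Matrix.diagonal a).mulVec (y origin - x origin) ≤ F (ω, y) - F (ω, x)

/-- The componentwise separating property of `F`. -/
def Separating {m : ℕ} (φ : Flow ℝ Ω) (a : Fin m → ℝ) (F : Ω × BC m → E m) : Prop :=
  ∀ (ω : Ω) (x y : BC m),
    HasBackwardOrbit φ (IsFDESol φ F) ω x → HasBackwardOrbit φ (IsFDESol φ F) ω y →
    ExpLE a x y → ∀ J : Set (Fin m), SeparatedOn J x y →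
    ∀ i ∈ J,
      0 < F (ω, y) i - F (ω, x) i - (Matrix.diagonal a).mulVec (y origin - x origin) i

/-- Every `B_k`, `k ∈ ℕ`, is uniformly stable for `≤_A`. -/
def BallsStable {m : ℕ} (φ : Flow ℝ Ω) (a : Fin m → ℝ) (F : Ω × BC m → E m) : Prop :=
  ∀ k : ℕ, UniformlyStable (IsFDESol φ F) (fun _ x y => ExpLE a x y) (ball m k)

/-! ### Order conditions on the neutral equation -/

/-- Quasimonotonicity of `G`: `(ω, x) ≤_{D,A} (ω, y)` implies
`G(ω, y) - G(ω, x) ≥ A (D(ω, y) - D(ω, x))`. -/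
def NeutralQuasimonotone {m : ℕ} (φ : Flow ℝ Ω) (D : Ω → BC m →L[ℝ] E m) (a : Fin m → ℝ)
    (G : Ω × BC m → E m) : Prop :=
  ∀ (ω : Ω) (x y : BC m), TransformedLE φ D a ω x y →
    (Matrix.diagonal a).mulVec (D ω y - D ω x) ≤ G (ω, y) - G (ω, x)

/-- The componentwise separating property of `G`. -/
def NeutralSeparating {m : ℕ} (φ : Flow ℝ Ω) (D : Ω → BC m →L[ℝ] E m) (a : Fin m → ℝ)
    (G : Ω × BC m → E m) : Prop :=
  ∀ (ω : Ω) (x y : BC m),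
    HasBackwardOrbit φ (IsNFDESol φ D G) ω x → HasBackwardOrbit φ (IsNFDESol φ D G) ω y →
    TransformedLE φ D a ω x y →
    ∀ J : Set (Fin m), SeparatedOn J (dHat₂ φ D ω x) (dHat₂ φ D ω y) →
    ∀ i ∈ J,
      0 < G (ω, y) i - G (ω, x) i - (Matrix.diagonal a).mulVec (D ω y - D ω x) i

/-- Every `B_k`, `k ∈ ℕ`, is uniformly stable for `≤_{D,A}`. -/
def NeutralBallsStable {m : ℕ} (φ : Flow ℝ Ω) (D : Ω → BC m →L[ℝ] E m) (a : Fin m → ℝ)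
    (G : Ω × BC m → E m) : Prop :=
  ∀ k : ℕ, UniformlyStable (IsNFDESol φ D G) (TransformedLE φ D a) (ball m k)

end Base

end

end NeutralFDE

namespace NeutralFDE

/-! ### Functions supported near the endpoint -/

/-! The core is that `D̂₂(ω, ·)` is invertible on `BC`, with an inverse bounded uniformly in `ω` and
continuous on balls for the compact-open topology. `D̂₂` commutes with translations (`shift_hat`),
so problems on a window of the past can be moved to one ending at `0`.

Since `μ(ω)({0}) = I`, on functions living on a short interval `[-r, 0]` the operator is within
`1/2` of the identity, with `r` independent of `ω` by compactness. A contraction argument solves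
`D̂₂(ω, u) = y` there, and stepping through windows of length `r` solves it on every `[-S, 0]`, with
a constant depending on `S` (`exists_hat_bijective_of_nonneg`).

Stability removes this dependence. A function is split into a part that is homogeneous on the last
`S` units of time, controlled by `c(S)`, and a part controlled by the solver on a bounded window;
hence `‖x(t)‖ ≤ c(S) ‖x‖ + C_S sup_{[t-S, t]} ‖D̂₂(ω, x)‖` (`exists_stability_estimate`). Taking
`c(S) < 1/2` gives a global lower bound. Taking `c(S)` arbitrarily small shows that values on `[-N,
0]` depend on the remote past only weakly, which yields surjectivity by approximation and
compact-open continuity of the inverse.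

Properties (F1)–(F3) then follow by substitution. For (F4) and (F5), the commutation with
translations makes `D̂` carry solutions and their segments to those of the transformed equation
(`segment_transport`), so backward orbits and stability are transported as well. -/

instance {X : Type*} [MeasurableSpace X] (μ : SignedMeasure X) :
    IsFiniteMeasure μ.variation := by
  rw [← SignedMeasure.totalVariation_eq_variation]
  infer_instance

/-- These intervals decrease to the empty set because the endpoint is excluded; the atom at `0` is
treated separately. -/
theorem tendsto_variation_Ioo_origin (μ : SignedMeasure (Iic (0 : ℝ))) :
    Tendsto (fun n : ℕ => μ.variation.real {s | -(1 / ((n : ℝ) + 1)) < (s : ℝ) ∧ (s : ℝ) < 0})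
      atTop (𝓝 0) := by
  have hm : ∀ n : ℕ, MeasurableSet {s : Iic (0 : ℝ) | -(1 / ((n : ℝ) + 1)) < (s : ℝ) ∧ (s : ℝ) < 0} :=
    fun n => (measurableSet_lt measurable_const measurable_subtype_coe).inter
      (measurableSet_lt measurable_subtype_coe measurable_const)
  have h := tendsto_measure_iInter_atTop (μ := μ.variation)
    (fun n => (hm n).nullMeasurableSet) (fun i j hij s hs => ?_) ⟨0, measure_ne_top _ _⟩
  · have he : (⋂ n : ℕ, {s : Iic (0 : ℝ) | -(1 / ((n : ℝ) + 1)) < (s : ℝ) ∧ (s : ℝ) < 0}) = ∅ := by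
      ext s
      simp only [mem_iInter, mem_ofPred_eq, mem_empty_iff_false, iff_false, not_forall]
      by_cases hs : (s : ℝ) < 0
      · obtain ⟨n, hn⟩ := exists_nat_one_div_lt (neg_pos.2 hs)
        exact ⟨n, fun h => by linarith [h.1]⟩
      · exact ⟨0, fun h => hs h.2⟩
    rw [he, measure_empty] at h
    exact (ENNReal.tendsto_toReal ENNReal.zero_ne_top).comp h
  · refine ⟨lt_of_le_of_lt ?_ hs.1, hs.2⟩
    have : (i : ℝ) ≤ j := by exact_mod_cast hij
    exact neg_le_neg (one_div_le_one_div_of_le (by positivity) (by linarith))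

/-- Away from the atom at `0` only the interval `(-r, 0)` contributes to the integral. -/
theorem abs_integral_sub_mass_origin_le (μ : SignedMeasure (Iic (0 : ℝ))) {f : Iic (0 : ℝ) → ℝ}
    (hf : Continuous f) {C r : ℝ} (hC : ∀ s, |f s| ≤ C)
    (hr : ∀ s : Iic (0 : ℝ), (s : ℝ) ≤ -r → f s = 0) :
    |(∫ᵛ s, f s ∂<•μ) - f origin * μ {origin}|
      ≤ C * μ.variation.real {s | -r < (s : ℝ) ∧ (s : ℝ) < 0} := by
  set U : Set (Iic (0 : ℝ)) := {s | -r < (s : ℝ) ∧ (s : ℝ) < 0} with hU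
  have hUm : MeasurableSet U := (measurableSet_lt measurable_const measurable_subtype_coe).inter
      (measurableSet_lt measurable_subtype_coe measurable_const)
  have hint : μ.Integrable f :=
    Integrable.of_bound hf.aestronglyMeasurable C (.of_forall fun s => by simpa using hC s)
  have hsub : U ⊆ {origin}ᶜ := fun s hs h => by
    rw [mem_singleton_iff] at h
    subst h
    exact lt_irrefl _ hs.2
  have h1 := VectorMeasure.setIntegral_add_compl (B := (ContinuousLinearMap.lsmul ℝ ℝ).flip)
    (measurableSet_singleton origin) hint
  have h2 := VectorMeasure.setIntegral_eq_of_subset_of_forall_sdiff_eq_zero (μ := μ) (f := f)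
    (B := (ContinuousLinearMap.lsmul ℝ ℝ).flip) hUm (measurableSet_singleton origin).compl
    hsub (fun s hs => hr s ?_)
  · rw [VectorMeasure.integral_singleton, h2] at h1
    have h3 := VectorMeasure.norm_setIntegral_le_of_norm_le_const (μ := μ) (s := U) (f := f)
      (B := (ContinuousLinearMap.lsmul ℝ ℝ (E := ℝ)).flip) (C := C)
      (fun s _ => by simpa using hC s)
    have hC0 : 0 ≤ C := (abs_nonneg _).trans (hC origin)
    rw [ContinuousLinearMap.opNorm_flip] at h3
    have h4 : (ContinuousLinearMap.lsmul ℝ ℝ).flip (f origin) (μ {origin})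
        = f origin * μ {origin} := by
      simp [mul_comm]
    rw [← h1, h4, add_sub_cancel_left, ← Real.norm_eq_abs]
    refine h3.trans (mul_le_mul_of_nonneg_right ?_ measureReal_nonneg)
    exact mul_le_of_le_one_right hC0 ContinuousLinearMap.opNorm_lsmul_le
  · by_contra h
    refine hs.2 ⟨not_le.1 h, lt_of_le_of_ne s.2 fun h0 => hs.1 ?_⟩
    exact Subtype.ext h0

theorem exists_norm_sub_apply_origin_le {m : ℕ} {L : BC m →L[ℝ] E m} (hL : massAtZero L = 1)
    {ε : ℝ} (hε : 0 < ε) :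
    ∃ r : ℝ, 0 < r ∧ ∀ u : BC m, (∀ s : Iic (0 : ℝ), (s : ℝ) ≤ -r → u s = 0) →
      ‖L u - u origin‖ ≤ ε * ‖u‖ := by
  rcases isEmpty_or_nonempty (Fin m) with hm | hm
  · refine ⟨1, one_pos, fun u _ => ?_⟩
    rw [Subsingleton.elim (L u - u origin) 0, norm_zero]
    positivity
  -- Without a representing matrix `massAtZero` takes the default value `0`, which differs from `1`
  -- because `m > 0` here.
  have hex : ∃ μ, Represents L μ := by
    by_contra h
    rw [massAtZero, dif_neg h] at hL
    obtain ⟨i⟩ := hm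
    simpa using congrFun (congrFun hL i) i
  rw [massAtZero, dif_pos hex] at hL
  have hrep := hex.choose_spec
  set μ := hex.choose
  have hmass : ∀ i j, μ i j {origin} = (1 : Matrix (Fin m) (Fin m) ℝ) i j := fun i j => by
    rw [← hL]; rfl
  have ht : Tendsto (fun n : ℕ => ∑ i, ∑ j,
      (μ i j).variation.real {s | -(1 / ((n : ℝ) + 1)) < (s : ℝ) ∧ (s : ℝ) < 0}) atTop (𝓝 0) := by
    simpa using tendsto_finsetSum Finset.univ fun i _ => tendsto_finsetSum Finset.univ
      fun j _ => tendsto_variation_Ioo_origin (μ i j)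
  obtain ⟨n, hn⟩ := (ht.eventually (gt_mem_nhds hε)).exists
  refine ⟨1 / ((n : ℝ) + 1), by positivity, fun u hu => ?_⟩
  refine (pi_norm_le_iff_of_nonneg (by positivity)).2 fun i => ?_
  have h0 : u origin i = ∑ j, u origin j * μ i j {origin} := by
    simp [hmass, Matrix.one_apply]
  rw [Pi.sub_apply, hrep u i, h0, ← Finset.sum_sub_distrib, Real.norm_eq_abs]
  refine (Finset.abs_sum_le_sum_abs _ _).trans ?_
  calc _ ≤ ∑ j, ‖u‖ * (μ i j).variation.real
        {s | -(1 / ((n : ℝ) + 1)) < (s : ℝ) ∧ (s : ℝ) < 0} := by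
        refine Finset.sum_le_sum fun j _ => ?_
        exact abs_integral_sub_mass_origin_le (μ i j) (f := fun s => u s j)
          ((continuous_apply j).comp u.continuous)
          (fun s => (norm_le_pi_norm (u s) j).trans (u.norm_coe_le_norm s))
          (fun s hs => by simp [hu s hs])
    _ ≤ ‖u‖ * ∑ i, ∑ j, (μ i j).variation.real
        {s | -(1 / ((n : ℝ) + 1)) < (s : ℝ) ∧ (s : ℝ) < 0} := by
        rw [← Finset.mul_sum]
        refine mul_le_mul_of_nonneg_left ?_ (norm_nonneg _)
        exact Finset.single_le_sum (f := fun i => ∑ j, (μ i j).variation.real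
          {s | -(1 / ((n : ℝ) + 1)) < (s : ℝ) ∧ (s : ℝ) < 0})
          (fun i _ => Finset.sum_nonneg fun j _ => measureReal_nonneg) (Finset.mem_univ i)
    _ ≤ ε * ‖u‖ := by
        rw [mul_comm]
        exact mul_le_mul_of_nonneg_right hn.le (norm_nonneg _)

/-- A radius valid at `ω₀` with `ε / 2` is valid with `ε` for all `ω` near `ω₀`, by continuity in
operator norm; compactness leaves finitely many radii. -/
theorem exists_forall_norm_sub_apply_origin_le {Ω : Type*} [TopologicalSpace Ω] [CompactSpace Ω]
    {m : ℕ} {D : Ω → BC m →L[ℝ] E m} (hD : Continuous D) (h0 : ∀ ω, massAtZero (D ω) = 1)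
    {ε : ℝ} (hε : 0 < ε) :
    ∃ r : ℝ, 0 < r ∧ ∀ (ω : Ω) (u : BC m), (∀ s : Iic (0 : ℝ), (s : ℝ) ≤ -r → u s = 0) →
      ‖D ω u - u origin‖ ≤ ε * ‖u‖ := by
  suffices h : ∃ r : ℝ, 0 < r ∧ ∀ ω ∈ (univ : Set Ω), ∀ u : BC m,
      (∀ s : Iic (0 : ℝ), (s : ℝ) ≤ -r → u s = 0) → ‖D ω u - u origin‖ ≤ ε * ‖u‖ by
    obtain ⟨r, hr, h⟩ := h
    exact ⟨r, hr, fun ω => h ω (mem_univ ω)⟩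
  refine isCompact_univ.induction_on (p := fun S : Set Ω => ∃ r : ℝ, 0 < r ∧ ∀ ω ∈ S, ∀ u : BC m,
      (∀ s : Iic (0 : ℝ), (s : ℝ) ≤ -r → u s = 0) → ‖D ω u - u origin‖ ≤ ε * ‖u‖)
    ⟨1, one_pos, by simp⟩ ?_ ?_ ?_
  · rintro S S' hS ⟨r, hr, h⟩
    exact ⟨r, hr, fun ω hω => h ω (hS hω)⟩
  · rintro S S' ⟨r, hr, h⟩ ⟨r', hr', h'⟩
    refine ⟨min r r', lt_min hr hr', fun ω hω u hu => ?_⟩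
    rcases hω with hω | hω
    · exact h ω hω u fun s hs => hu s (hs.trans (neg_le_neg (min_le_left _ _)))
    · exact h' ω hω u fun s hs => hu s (hs.trans (neg_le_neg (min_le_right _ _)))
  · intro ω₀ _
    obtain ⟨r, hr, h⟩ := exists_norm_sub_apply_origin_le (h0 ω₀) (half_pos hε)
    refine ⟨D ⁻¹' Metric.ball (D ω₀) (ε / 2), mem_nhdsWithin_of_mem_nhds
      (hD.continuousAt.preimage_mem_nhds (Metric.ball_mem_nhds (α := BC m →L[ℝ] E m) (D ω₀) (half_pos hε))), r, hr,
      fun ω hω u hu => ?_⟩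
    have h1 := h u hu
    have h2 : ‖(D ω - D ω₀) u‖ ≤ ε / 2 * ‖u‖ :=
      ((D ω - D ω₀).le_opNorm u).trans (mul_le_mul_of_nonneg_right
        (by rw [← dist_eq_norm]; exact le_of_lt hω) (norm_nonneg _))
    calc ‖D ω u - u origin‖ = ‖(D ω - D ω₀) u + (D ω₀ u - u origin)‖ := by simp
      _ ≤ _ := norm_add_le _ _
      _ ≤ ε * ‖u‖ := by linarith

/-! ### The compact-open metric -/

theorem norm_apply_le_seminormOn {m : ℕ} (n : ℕ) (x : BC m) {s : Iic (0 : ℝ)}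
    (hs : -(n : ℝ) ≤ (s : ℝ)) : ‖x s‖ ≤ seminormOn n x :=
  le_ciSup (f := fun s : {s : Iic (0 : ℝ) // -(n : ℝ) ≤ (s : ℝ)} => ‖x s.1‖)
    ⟨‖x‖, by rintro _ ⟨s, rfl⟩; exact x.norm_coe_le_norm _⟩ ⟨s, hs⟩

theorem seminormOn_nonneg {m : ℕ} (n : ℕ) (x : BC m) : 0 ≤ seminormOn n x :=
  Real.iSup_nonneg fun _ => norm_nonneg _

theorem seminormOn_le {m : ℕ} {n : ℕ} {x : BC m} {C : ℝ} (hC : 0 ≤ C)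
    (h : ∀ s : Iic (0 : ℝ), -(n : ℝ) ≤ (s : ℝ) → ‖x s‖ ≤ C) : seminormOn n x ≤ C :=
  Real.iSup_le (fun s => h s.1 s.2) hC

theorem div_one_add_le_one {q : ℝ} (hq : 0 ≤ q) : q / (1 + q) ≤ 1 :=
  (div_le_one (by positivity)).2 (by linarith)

theorem div_one_add_le_self {q : ℝ} (hq : 0 ≤ q) : q / (1 + q) ≤ q :=
  div_le_self hq (by linarith)

theorem summable_coDist {m : ℕ} (x y : BC m) : Summable fun n : ℕ => (1 / 2 : ℝ) ^ (n + 1) *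
    (seminormOn (n + 1) (x - y) / (1 + seminormOn (n + 1) (x - y))) := by
  refine Summable.of_nonneg_of_le (fun n => ?_) (fun n => ?_)
    ((summable_nat_add_iff 1).2 summable_geometric_two)
  · have := seminormOn_nonneg (n + 1) (x - y)
    positivity
  · exact mul_le_of_le_one_right (by positivity) (div_one_add_le_one (seminormOn_nonneg _ _))

theorem coDist_nonneg {m : ℕ} (x y : BC m) : 0 ≤ coDist x y :=
  tsum_nonneg fun n => by
    have := seminormOn_nonneg (n + 1) (x - y)
    positivity

/-- Functions that are uniformly close on a long interval `[-N, 0]` are close for `coDist`. -/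
theorem exists_coDist_lt {m : ℕ} {ε : ℝ} (hε : 0 < ε) : ∃ N : ℕ, ∃ η : ℝ, 0 < η ∧ ∀ x y : BC m,
    (∀ s : Iic (0 : ℝ), -(N : ℝ) ≤ (s : ℝ) → ‖x s - y s‖ ≤ η) → coDist x y < ε := by
  obtain ⟨N, hN⟩ := exists_pow_lt_of_lt_one (half_pos hε) (by norm_num : (1 / 2 : ℝ) < 1)
  refine ⟨N, ε / 4, by positivity, fun x y h => ?_⟩
  have hs := summable_coDist x y
  rw [coDist, ← hs.sum_add_tsum_nat_add N]
  have h1 : ∑ n ∈ Finset.range N, (1 / 2 : ℝ) ^ (n + 1) *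
      (seminormOn (n + 1) (x - y) / (1 + seminormOn (n + 1) (x - y))) ≤ ε / 4 := by
    calc _ ≤ ∑ n ∈ Finset.range N, (1 / 2 : ℝ) ^ (n + 1) * (ε / 4) := by
          refine Finset.sum_le_sum fun n hn => ?_
          refine mul_le_mul_of_nonneg_left ?_ (by positivity)
          refine (div_one_add_le_self (seminormOn_nonneg _ _)).trans
            (seminormOn_le (by positivity) fun s hs => h s ?_)
          have : ((n + 1 : ℕ) : ℝ) ≤ N := by exact_mod_cast Finset.mem_range.1 hn
          linarith
      _ ≤ 1 * (ε / 4) := by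
          rw [← Finset.sum_mul]
          refine mul_le_mul_of_nonneg_right ?_ (by positivity)
          calc _ ≤ ∑' n : ℕ, (1 / 2 : ℝ) ^ (n + 1) :=
                Summable.sum_le_tsum _ (fun _ _ => by positivity)
                  ((summable_nat_add_iff 1).2 summable_geometric_two)
            _ = 1 := by
                simp_rw [pow_succ, tsum_mul_right, tsum_geometric_two]; norm_num
      _ = ε / 4 := one_mul _
  have h2 : ∑' n : ℕ, (1 / 2 : ℝ) ^ (n + N + 1) *
      (seminormOn (n + N + 1) (x - y) / (1 + seminormOn (n + N + 1) (x - y))) ≤ (1 / 2) ^ N := by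
    have hg : ∀ n : ℕ, (1 / 2 : ℝ) ^ (n + N + 1) = (1 / 2) ^ N * (1 / 2) * (1 / 2) ^ n :=
      fun n => by ring
    calc _ ≤ ∑' n : ℕ, (1 / 2 : ℝ) ^ (n + N + 1) := by
          refine Summable.tsum_le_tsum (fun n => ?_) ((summable_nat_add_iff N).2 hs) ?_
          · exact mul_le_of_le_one_right (by positivity)
              (div_one_add_le_one (seminormOn_nonneg _ _))
          · simp_rw [hg]; exact summable_geometric_two.mul_left _
      _ = (1 / 2) ^ N := by
          simp_rw [hg, tsum_mul_left, tsum_geometric_two]; ring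
  linarith

/-- Functions that are close for `coDist` are uniformly close on `[-N, 0]`. -/
theorem exists_forall_norm_sub_lt {m : ℕ} (N : ℕ) {η : ℝ} (hη : 0 < η) :
    ∃ δ : ℝ, 0 < δ ∧ ∀ x y : BC m, coDist x y < δ →
      ∀ s : Iic (0 : ℝ), -(N : ℝ) ≤ (s : ℝ) → ‖x s - y s‖ < η := by
  -- One term of the series suffices: index `N` carries the seminorm on `[-(N + 1), 0]`, and `q ↦ q
  -- / (1 + q)` is increasing.
  refine ⟨(1 / 2) ^ (N + 1) * (η / (1 + η)), by positivity, fun x y h s hs => ?_⟩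
  set q := seminormOn (N + 1) (x - y)
  have hq : 0 ≤ q := seminormOn_nonneg _ _
  have h1 : (1 / 2 : ℝ) ^ (N + 1) * (q / (1 + q)) ≤ coDist x y :=
    (summable_coDist x y).le_tsum N fun n _ => by
      have := seminormOn_nonneg (n + 1) (x - y)
      positivity
  have h2 : q / (1 + q) < η / (1 + η) := lt_of_mul_lt_mul_left (h1.trans_lt h) (by positivity)
  have h3 : q < η := by
    rw [div_lt_div_iff₀ (by positivity) (by positivity)] at h2
    linarith
  refine lt_of_le_of_lt ?_ h3
  exact norm_apply_le_seminormOn (N + 1) (x - y) (by push_cast; linarith)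

theorem tendsto_coDist_zero {ι : Type*} {l : Filter ι} {m : ℕ} {x' : ι → BC m} {x : BC m}
    (h : ∀ (N : ℕ) (η : ℝ), 0 < η → ∀ᶠ i in l, ∀ s : Iic (0 : ℝ), -(N : ℝ) ≤ (s : ℝ) →
      ‖x' i s - x s‖ ≤ η) : Tendsto (fun i => coDist (x' i) x) l (𝓝 0) := by
  refine Metric.tendsto_nhds.2 fun ε hε => ?_
  obtain ⟨N, η, hη, hN⟩ := exists_coDist_lt (m := m) hε
  filter_upwards [h N η hη] with i hi
  rw [Real.dist_0_eq_abs, abs_of_nonneg (coDist_nonneg _ _)]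
  exact hN _ _ hi

theorem eventually_norm_sub_lt_of_tendsto_coDist {ι : Type*} {l : Filter ι} {m : ℕ}
    {x' : ι → BC m} {x : BC m} (h : Tendsto (fun i => coDist (x' i) x) l (𝓝 0)) (N : ℕ) {η : ℝ}
    (hη : 0 < η) : ∀ᶠ i in l, ∀ s : Iic (0 : ℝ), -(N : ℝ) ≤ (s : ℝ) → ‖x' i s - x s‖ < η := by
  obtain ⟨δ, hδ, hN⟩ := exists_forall_norm_sub_lt (m := m) N hη
  filter_upwards [h.eventually (gt_mem_nhds hδ)] with i hi
  exact hN _ _ hi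

/-! ### Translates -/

@[simp]
theorem origin_coe : ((origin : Iic (0 : ℝ)) : ℝ) = 0 := rfl

theorem BC.congr_apply {m : ℕ} (x : BC m) {s t : Iic (0 : ℝ)} (h : (s : ℝ) = t) : x s = x t :=
  congrArg x (Subtype.ext h)

theorem coe_nonpos (s : Iic (0 : ℝ)) : (s : ℝ) ≤ 0 := mem_Iic.1 s.2

theorem add_mem_Iic (s r : Iic (0 : ℝ)) : (s : ℝ) + r ∈ Iic (0 : ℝ) :=
  mem_Iic.2 (add_nonpos (coe_nonpos s) (coe_nonpos r))

theorem min_mem_Iic (t : ℝ) : min t 0 ∈ Iic (0 : ℝ) := mem_Iic.2 (min_le_right _ _)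

theorem shift_apply {m : ℕ} (x : BC m) (s r : Iic (0 : ℝ)) :
    shift x s r = x ⟨(s : ℝ) + r, add_mem_Iic s r⟩ := rfl

@[simp]
theorem shift_apply_origin {m : ℕ} (x : BC m) (s : Iic (0 : ℝ)) : shift x s origin = x s :=
  x.congr_apply (add_zero _)

@[simp]
theorem shift_origin {m : ℕ} (x : BC m) : shift x origin = x := by
  ext1 s
  exact x.congr_apply (zero_add _)

theorem shift_shift {m : ℕ} (x : BC m) (s r : Iic (0 : ℝ)) :
    shift (shift x s) r = shift x ⟨(s : ℝ) + r, add_mem_Iic s r⟩ := by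
  ext1 q
  exact x.congr_apply (add_assoc _ _ _).symm

theorem shift_add {m : ℕ} (x y : BC m) (s : Iic (0 : ℝ)) :
    shift (x + y) s = shift x s + shift y s := rfl

theorem shift_sub {m : ℕ} (x y : BC m) (s : Iic (0 : ℝ)) :
    shift (x - y) s = shift x s - shift y s := rfl

theorem norm_shift_le {m : ℕ} (x : BC m) (s : Iic (0 : ℝ)) : ‖shift x s‖ ≤ ‖x‖ :=
  (BoundedContinuousFunction.norm_le (norm_nonneg _)).2 fun _ => x.norm_coe_le_norm _

/-- Translation is continuous for the compact-open topology. -/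
theorem tendsto_coDist_shift {ι : Type*} {l : Filter ι} {m : ℕ} (x : BC m)
    {s' : ι → Iic (0 : ℝ)} {s : Iic (0 : ℝ)} (hs : Tendsto s' l (𝓝 s)) :
    Tendsto (fun i => coDist (shift x (s' i)) (shift x s)) l (𝓝 0) := by
  refine tendsto_coDist_zero fun N η hη => ?_
  -- Uniform convergence on the compact interval `[-N, 0]` is continuity of the curried map.
  let f : C(Iic (0 : ℝ) × Icc (-(N : ℝ)) 0, E m) :=
    ⟨fun p => x ⟨(p.1 : ℝ) + p.2, add_mem_Iic p.1 ⟨p.2, mem_Iic.2 p.2.2.2⟩⟩, by fun_prop⟩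
  have h1 := (f.curry.continuous.tendsto s).comp hs
  filter_upwards [h1 (Metric.ball_mem_nhds _ hη)] with i hi r hr
  have h2 := (ContinuousMap.dist_apply_le_dist (f := f.curry (s' i)) (g := f.curry s)
    ⟨r, hr, coe_nonpos r⟩).trans hi.le
  rwa [dist_eq_norm] at h2

/-! ### Extending and truncating histories -/

/-- The point `-S` of `(-∞, 0]`. -/
def past (S : ℝ) (hS : 0 ≤ S) : Iic (0 : ℝ) := ⟨-S, mem_Iic.2 (neg_nonpos.2 hS)⟩

@[simp]
theorem past_coe (S : ℝ) (hS : 0 ≤ S) : (past S hS : ℝ) = -S := rfl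

/-- The function `s ↦ x (min (g s) 0)`. -/
noncomputable def reparam {m : ℕ} (g : C(ℝ, ℝ)) (x : BC m) : BC m :=
  x.compContinuous ⟨fun s => ⟨min (g s) 0, min_mem_Iic _⟩,
    Continuous.subtype_mk (by fun_prop) _⟩

theorem norm_reparam_le {m : ℕ} (g : C(ℝ, ℝ)) (x : BC m) : ‖reparam g x‖ ≤ ‖x‖ :=
  (BoundedContinuousFunction.norm_le (norm_nonneg _)).2 fun _ => x.norm_coe_le_norm _

/-- The function equal to `x (s + S)` for `s ≤ -S` and to `x 0` on `[-S, 0]`. -/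
noncomputable def delay {m : ℕ} (S : ℝ) (x : BC m) : BC m := reparam ⟨fun s => s + S, by fun_prop⟩ x

theorem shift_delay {m : ℕ} {S : ℝ} (hS : 0 ≤ S) (x : BC m) :
    shift (delay S x) (past S hS) = x := by
  ext1 s
  refine x.congr_apply ?_
  have hs := coe_nonpos s
  simpa using hs

theorem norm_delay_le {m : ℕ} (S : ℝ) (x : BC m) : ‖delay S x‖ ≤ ‖x‖ := norm_reparam_le _ _

/-- The function equal to `x s` for `s ≥ -S` and to `x (-S)` for `s ≤ -S`. -/
noncomputable def freeze {m : ℕ} (S : ℝ) (x : BC m) : BC m :=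
  reparam ⟨fun s => max s (-S), by fun_prop⟩ x

theorem freeze_apply_of_ge {m : ℕ} {S : ℝ} (x : BC m) {s : Iic (0 : ℝ)} (hs : -S ≤ (s : ℝ)) :
    freeze S x s = x s := by
  refine x.congr_apply ?_
  have hs0 := coe_nonpos s
  simp [hs, hs0]

theorem freeze_apply_of_le {m : ℕ} {S : ℝ} (hS : 0 ≤ S) (x : BC m) {s : Iic (0 : ℝ)}
    (hs : (s : ℝ) ≤ -S) : freeze S x s = x (past S hS) := by
  refine x.congr_apply ?_
  simp [hs, hS]

/-- `u` vanishes on `(-∞, -S]`. -/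
def VanishesBefore {m : ℕ} (S : ℝ) (u : BC m) : Prop := ∀ s : Iic (0 : ℝ), (s : ℝ) ≤ -S → u s = 0

theorem vanishesBefore_iff_shift_eq_zero {m : ℕ} {S : ℝ} (hS : 0 ≤ S) {u : BC m} :
    VanishesBefore S u ↔ shift u (past S hS) = 0 := by
  constructor
  · intro h
    ext1 s
    have hs := coe_nonpos s
    exact h _ (by simp [hs])
  · intro h s hs
    refine (u.congr_apply ?_).trans (DFunLike.congr_fun h ⟨(s : ℝ) + S, mem_Iic.2 (by linarith)⟩)
    simp

theorem VanishesBefore.shift {m : ℕ} {S : ℝ} {u : BC m} (h : VanishesBefore S u)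
    (s : Iic (0 : ℝ)) : VanishesBefore S (shift u s) := fun r hr =>
  h _ (by
    have hs := coe_nonpos s
    change (s : ℝ) + r ≤ -S
    linarith)

theorem VanishesBefore.sub {m : ℕ} {S : ℝ} {u v : BC m} (hu : VanishesBefore S u)
    (hv : VanishesBefore S v) : VanishesBefore S (u - v) := fun s hs => by
  simp [hu s hs, hv s hs]

theorem VanishesBefore.add {m : ℕ} {S : ℝ} {u v : BC m} (hu : VanishesBefore S u)
    (hv : VanishesBefore S v) : VanishesBefore S (u + v) := fun s hs => by
  simp [hu s hs, hv s hs]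

theorem VanishesBefore.mono {m : ℕ} {S S' : ℝ} {u : BC m} (hu : VanishesBefore S u)
    (h : S ≤ S') : VanishesBefore S' u := fun s hs => hu s (by linarith)

theorem isClosed_vanishesBefore (m : ℕ) (S : ℝ) : IsClosed {u : BC m | VanishesBefore S u} := by
  have : {u : BC m | VanishesBefore S u}
      = ⋂ s : Iic (0 : ℝ), ⋂ _ : (s : ℝ) ≤ -S, {u : BC m | u s = 0} := by
    ext u
    simp [VanishesBefore]
  rw [this]
  exact isClosed_iInter fun s => isClosed_iInter fun _ =>
    isClosed_eq ((continuous_eval_const s)) continuous_const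

/-! ### The operator `D̂₂(ω, ·)` on `BC` -/

variable {Ω : Type*} [MetricSpace Ω] {m : ℕ} {φ : Flow ℝ Ω}
  {D : Ω → BC m →L[ℝ] E m}

/-- Conditions (D1)–(D4) on the operator `D`. -/
structure IsAdmissible (φ : Flow ℝ Ω) (D : Ω → BC m →L[ℝ] E m) : Prop where
  continuous : Continuous D
  compactOpenRegular : CompactOpenRegular (fun p : Ω × BC m => D p.1 p.2)
  massAtZero : ∀ ω, massAtZero (D ω) = 1
  stable : StableOperator φ D

theorem flow_neg_add (φ : Flow ℝ Ω) (t : ℝ) (ω : Ω) : φ t (φ (-t) ω) = ω := by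
  rw [← Flow.map_add, add_neg_cancel, Flow.map_zero_apply]

namespace IsAdmissible

/-- Translation need not be continuous in the supremum norm, so the argument goes through (D2): the
translates stay in one ball and converge for `coDist`. -/
theorem continuous_dHat₂_uncurry (h : IsAdmissible φ D) (x : BC m) :
    Continuous fun p : Ω × Iic (0 : ℝ) => dHat₂ φ D p.1 x p.2 := by
  refine SeqContinuous.continuous fun p' p hp => ?_
  refine h.compactOpenRegular (‖x‖ + 1) (by positivity) (fun n => φ ((p' n).2 : ℝ) (p' n).1) _
    (fun n => shift x (p' n).2) _
    (fun n => (norm_shift_le _ _).trans (by linarith)) ((norm_shift_le _ _).trans (by linarith))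
    ?_ (tendsto_coDist_shift x ((continuous_snd.tendsto p).comp hp))
  exact ((φ.continuous (continuous_subtype_val.comp continuous_snd) continuous_fst).tendsto p).comp
    hp

theorem continuous_dHat₂ (h : IsAdmissible φ D) (ω : Ω) (x : BC m) :
    Continuous (dHat₂ φ D ω x) :=
  (h.continuous_dHat₂_uncurry x).comp (Continuous.prodMk_right ω)

variable [CompactSpace Ω]

theorem exists_bound (h : IsAdmissible φ D) : ∃ M : ℝ, 0 ≤ M ∧ ∀ ω, ‖D ω‖ ≤ M := by
  obtain ⟨M, hM⟩ := isCompact_univ.exists_bound_of_continuousOn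
    (E := BC m →L[ℝ] E m) (f := D) h.continuous.continuousOn
  exact ⟨max M 0, le_max_right _ _, fun ω => (hM ω (mem_univ ω)).trans (le_max_left _ _)⟩

/-- A bound for the norms of the operators `D(ω, ·)`. -/
noncomputable def bound (h : IsAdmissible φ D) : ℝ := h.exists_bound.choose

theorem bound_nonneg (h : IsAdmissible φ D) : 0 ≤ h.bound := h.exists_bound.choose_spec.1

theorem norm_dHat₂_le (h : IsAdmissible φ D) (ω : Ω) (x : BC m) (s : Iic (0 : ℝ)) :
    ‖dHat₂ φ D ω x s‖ ≤ h.bound * ‖x‖ :=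
  ((D _).le_opNorm _).trans (mul_le_mul (h.exists_bound.choose_spec.2 _) (norm_shift_le _ _)
    (norm_nonneg _) h.bound_nonneg)

/-- The operator `D̂₂(ω, ·)` as a continuous linear operator on `BC`. -/
noncomputable def hat (h : IsAdmissible φ D) (ω : Ω) : BC m →L[ℝ] BC m :=
  LinearMap.mkContinuous
    { toFun := fun x => BoundedContinuousFunction.ofNormedAddCommGroup (dHat₂ φ D ω x)
        (h.continuous_dHat₂ ω x) (h.bound * ‖x‖) (h.norm_dHat₂_le ω x)
      map_add' := fun x y => by
        ext1 s
        exact (D (φ (s : ℝ) ω)).map_add (shift x s) (shift y s)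
      map_smul' := fun c x => by
        ext1 s
        exact (D (φ (s : ℝ) ω)).map_smul c (shift x s) } h.bound fun x =>
    (BoundedContinuousFunction.norm_le (mul_nonneg h.bound_nonneg (norm_nonneg _))).2
      (h.norm_dHat₂_le ω x)

theorem hat_apply (h : IsAdmissible φ D) (ω : Ω) (x : BC m) (s : Iic (0 : ℝ)) :
    h.hat ω x s = D (φ (s : ℝ) ω) (shift x s) := rfl

theorem coe_hat (h : IsAdmissible φ D) (ω : Ω) (x : BC m) : ⇑(h.hat ω x) = dHat₂ φ D ω x := rfl

@[simp]
theorem hat_apply_origin (h : IsAdmissible φ D) (ω : Ω) (x : BC m) :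
    h.hat ω x origin = D ω x := by
  rw [hat_apply, shift_origin, origin_coe, Flow.map_zero_apply]

theorem norm_hat_le (h : IsAdmissible φ D) (ω : Ω) (x : BC m) :
    ‖h.hat ω x‖ ≤ h.bound * ‖x‖ :=
  (BoundedContinuousFunction.norm_le (mul_nonneg h.bound_nonneg (norm_nonneg _))).2
      (h.norm_dHat₂_le ω x)

/-- This commutation with translations is what localizes every later problem in time. -/
theorem shift_hat (h : IsAdmissible φ D) (ω : Ω) (x : BC m) (s : Iic (0 : ℝ)) :
    shift (h.hat ω x) s = h.hat (φ (s : ℝ) ω) (shift x s) := by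
  ext1 r
  rw [shift_apply, hat_apply, hat_apply, shift_shift, ← Flow.map_add, add_comm (r : ℝ)]

theorem _root_.NeutralFDE.VanishesBefore.hat {S : ℝ} (hS : 0 ≤ S) {u : BC m}
    (hu : VanishesBefore S u) (h : IsAdmissible φ D) (ω : Ω) : VanishesBefore S (h.hat ω u) := by
  rw [vanishesBefore_iff_shift_eq_zero hS] at hu ⊢
  rw [shift_hat, hu, map_zero]

/-! ### Functions vanishing in the distant past -/

/-- The equation `D̂₂(ω, u) = y` is uniquely solvable among functions vanishing before a small
time `-r`. -/
theorem exists_hat_bijective_small (h : IsAdmissible φ D) : ∃ r : ℝ, 0 < r ∧ ∀ ω,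
    (∀ u, VanishesBefore r u → ‖u‖ ≤ 2 * ‖h.hat ω u‖) ∧
    ∀ y, VanishesBefore r y → ∃ u, VanishesBefore r u ∧ h.hat ω u = y := by
  obtain ⟨r, hr, hD⟩ := exists_forall_norm_sub_apply_origin_le h.continuous h.massAtZero
    (one_half_pos (α := ℝ))
  -- Translates of `u` to the left still vanish before `-r`, so the estimate at the endpoint applies
  -- at every time.
  have key : ∀ ω u, VanishesBefore r u → ‖u - h.hat ω u‖ ≤ 1 / 2 * ‖u‖ := fun ω u hu => by
    refine (BoundedContinuousFunction.norm_le (by positivity)).2 fun s => ?_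
    have h1 := hD (φ (s : ℝ) ω) (shift u s) (hu.shift s)
    rw [shift_apply_origin, norm_sub_rev] at h1
    exact h1.trans (mul_le_mul_of_nonneg_left (norm_shift_le _ _) (by norm_num))
  refine ⟨r, hr, fun ω => ⟨fun u hu => ?_, fun y hy => ?_⟩⟩
  · have h1 : ‖u‖ ≤ ‖u - h.hat ω u‖ + ‖h.hat ω u‖ := by
      simpa using norm_add_le (u - h.hat ω u) (h.hat ω u)
    linarith [key ω u hu]
  -- A fixed point of `f` solves the equation, and `key` makes `f` a contraction of ratio `1/2`.
  · let f : BC m → BC m := fun u => u - h.hat ω u + y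
    have hf : MapsTo f {u | VanishesBefore r u} {u | VanishesBefore r u} := fun u hu =>
      (VanishesBefore.sub hu (VanishesBefore.hat hr.le hu h ω)).add hy
    have hc : ContractingWith (1 / 2) (hf.restrict f _ _) := by
      refine ⟨by
        rw [← NNReal.coe_lt_coe]
        norm_num, LipschitzWith.of_dist_le_mul fun u v => ?_⟩
      rw [Subtype.dist_eq, Subtype.dist_eq, dist_eq_norm, dist_eq_norm]
      have h1 := key ω (u.1 - v.1) (u.2.sub v.2)
      have h2 : f u.1 - f v.1 = (u.1 - v.1) - h.hat ω (u.1 - v.1) := by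
        simp only [f, map_sub]
        abel
      simpa [h2] using h1
    obtain ⟨u, hu, hfix, -⟩ := hc.exists_fixedPoint' (isClosed_vanishesBefore m r).isComplete hf
      (x := 0) (fun s _ => rfl) (edist_ne_top _ _)
    refine ⟨u, hu, ?_⟩
    have h1 : u - h.hat ω u + y = u := hfix
    have h2 : y - h.hat ω u = 0 := by
      calc y - h.hat ω u = (u - h.hat ω u + y) - u := by abel
        _ = 0 := by rw [h1, sub_self]
    exact (sub_eq_zero.1 h2).symm

/-- Induction on the number of windows: the oldest window, translated to end at `0`, is the small
problem over a translated base point; what remains vanishes before `-nr`. The constants do not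
depend on `ω`. -/
theorem exists_hat_bijective (h : IsAdmissible φ D) : ∃ r : ℝ, 0 < r ∧ ∀ n : ℕ, ∃ K : ℝ, 0 ≤ K ∧
    ∀ ω, (∀ u, VanishesBefore (n * r) u → ‖u‖ ≤ K * ‖h.hat ω u‖) ∧
      ∀ y, VanishesBefore (n * r) y → ∃ u, VanishesBefore (n * r) u ∧ h.hat ω u = y := by
  obtain ⟨r, hr, h0⟩ := h.exists_hat_bijective_small
  refine ⟨r, hr, fun n => ?_⟩
  induction n with
  | zero =>
    have hz : ∀ u : BC m, VanishesBefore ((0 : ℕ) * r) u → u = 0 := fun u hu => by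
      ext1 s
      have hs := coe_nonpos s
      exact hu s (by simpa using hs)
    refine ⟨0, le_rfl, fun ω => ⟨fun u hu => by simp [hz u hu], fun y hy => ⟨0, fun s _ => rfl, ?_⟩⟩⟩
    rw [hz y hy, map_zero]
  | succ n ih =>
    obtain ⟨K, hK, hn⟩ := ih
    have hS : 0 ≤ n * r := by positivity
    set S := n * r with hSdef
    set p := past S hS
    have hS' : ((n + 1 : ℕ) : ℝ) * r = S + r := by push_cast; ring
    have hsh : ∀ u : BC m, VanishesBefore (S + r) u ↔ VanishesBefore r (shift u p) := fun u => by
      constructor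
      · intro hu s hs
        exact hu _ (by change -S + (s : ℝ) ≤ -(S + r); linarith)
      · intro hu s hs
        have h1 := hu ⟨(s : ℝ) + S, mem_Iic.2 (by linarith)⟩ (by simp only; linarith)
        rw [← h1]
        exact u.congr_apply (by simp [p])
    rw [hS']
    have hM := h.bound_nonneg
    refine ⟨K * (1 + 2 * h.bound) + 2, by positivity, fun ω => ⟨fun u hu => ?_, fun y hy => ?_⟩⟩
    · have h1 := (h0 (φ (p : ℝ) ω)).1 _ ((hsh u).1 hu)
      rw [← shift_hat] at h1
      have h2 : ‖shift u p‖ ≤ 2 * ‖h.hat ω u‖ := by linarith [norm_shift_le (h.hat ω u) p]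
      -- `ξ` agrees with `u` up to time `-S` and is constant afterwards, so the induction hypothesis
      -- applies to `u - ξ`.
      set ξ := delay S (shift u p)
      have h3 : ‖ξ‖ ≤ 2 * ‖h.hat ω u‖ := (norm_delay_le _ _).trans h2
      have h4 := (hn ω).1 (u - ξ) ((vanishesBefore_iff_shift_eq_zero hS).2 (by
        rw [shift_sub, shift_delay, sub_self]))
      have h5 : ‖h.hat ω (u - ξ)‖ ≤ ‖h.hat ω u‖ + h.bound * (2 * ‖h.hat ω u‖) := by
        rw [map_sub]
        exact (norm_sub_le _ _).trans (add_le_add le_rfl ((h.norm_hat_le ω ξ).trans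
          (mul_le_mul_of_nonneg_left h3 hM)))
      have h6 : ‖u‖ ≤ ‖u - ξ‖ + ‖ξ‖ := by simpa using norm_add_le (u - ξ) ξ
      have h7 := mul_le_mul_of_nonneg_left h5 hK
      linarith
    -- `x₁` solves on the oldest window; `x₂` corrects the error made on `[-S, 0]` by its constant
    -- continuation.
    · obtain ⟨x₁, hx₁, hx₁y⟩ := (h0 (φ (p : ℝ) ω)).2 _ ((hsh y).1 hy)
      obtain ⟨x₂, hx₂, hx₂y⟩ := (hn ω).2 (y - h.hat ω (delay S x₁))
        ((vanishesBefore_iff_shift_eq_zero hS).2 (by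
          rw [shift_sub, shift_hat, shift_delay, hx₁y, sub_self]))
      refine ⟨delay S x₁ + x₂, ?_, by rw [map_add, hx₂y]; abel⟩
      rw [hsh, shift_add, shift_delay, (vanishesBefore_iff_shift_eq_zero hS).1 hx₂, add_zero]
      exact hx₁

end IsAdmissible

/-! ### Segments -/

theorem segment_eq {m : ℕ} {z : ℝ → E m} {t : ℝ} {x : BC m}
    (h : ∀ s : Iic (0 : ℝ), z (t + s) = x s) : segment z t = x := by
  have h1 : (fun s : Iic (0 : ℝ) => z (t + s)) = x := funext h
  ext1 s
  rw [segment_apply (by rw [h1]; exact x.continuous)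
    ⟨‖x‖, fun s => by rw [h s]; exact x.norm_coe_le_norm s⟩, h s]

theorem add_coe_mem_Iic {t T : ℝ} (ht : t ≤ T) (s : Iic (0 : ℝ)) : t + (s : ℝ) ∈ Iic T :=
  mem_Iic.2 (by linarith [coe_nonpos s])

/-- A function continuous on `(-∞, T]` and bounded on `(-∞, 0]` has segments up to time `T`. -/
theorem segment_apply_of_continuousOn {m : ℕ} {z : ℝ → E m} {T : ℝ} {x : BC m}
    (hz : ContinuousOn z (Iic T)) (hx : ∀ s : Iic (0 : ℝ), z s = x s) {t : ℝ} (ht : t ≤ T)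
    (s : Iic (0 : ℝ)) : segment z t s = z (t + s) := by
  refine segment_apply ?_ ?_ s
  · exact hz.comp_continuous (by fun_prop) (add_coe_mem_Iic ht)
  · obtain ⟨C, hC⟩ := (isCompact_Icc (a := (0 : ℝ)) (b := T)).exists_bound_of_continuousOn
      (hz.mono fun _ h => h.2)
    refine ⟨max C ‖x‖, fun s => ?_⟩
    rcases le_total (t + (s : ℝ)) 0 with h0 | h0
    · have := hx ⟨t + s, h0⟩
      simp only at this
      rw [this]
      exact (x.norm_coe_le_norm _).trans (le_max_right _ _)
    · exact (hC _ ⟨h0, add_coe_mem_Iic ht s⟩).trans (le_max_left _ _)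

theorem segment_zero_of_continuousOn {m : ℕ} {z : ℝ → E m} {x : BC m}
    (hx : ∀ s : Iic (0 : ℝ), z s = x s) : segment z 0 = x :=
  segment_eq fun s => by rw [zero_add, hx]

theorem shift_segment {m : ℕ} {z : ℝ → E m} {T : ℝ} {x : BC m}
    (hz : ContinuousOn z (Iic T)) (hx : ∀ s : Iic (0 : ℝ), z s = x s) {t : ℝ} (ht : t ≤ T)
    (s : Iic (0 : ℝ)) : shift (segment z t) s = segment z (t + s) := by
  ext1 r
  rw [shift_apply, segment_apply_of_continuousOn hz hx ht,
    segment_apply_of_continuousOn hz hx (add_coe_mem_Iic ht s), add_assoc]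

/-! ### Cut-off -/

/-- A function that coincides with `y` on `[-S, 0]` and vanishes before `-(S + 1)`. -/
theorem exists_cutoff {m : ℕ} {S : ℝ} (hS : 0 ≤ S) (y : BC m) {B : ℝ}
    (hB : ∀ s : Iic (0 : ℝ), -S ≤ (s : ℝ) → ‖y s‖ ≤ B) :
    ∃ y' : BC m, VanishesBefore (S + 1) y' ∧ ‖y'‖ ≤ B ∧
      ∀ s : Iic (0 : ℝ), -S ≤ (s : ℝ) → y' s = y s := by
  have hB0 : 0 ≤ B := (norm_nonneg _).trans (hB origin (by simpa using hS))
  -- The bound `B` is known only on `[-S, 0]`: freezing extends it to the half-line, and the ramp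
  -- then brings the function down to zero.
  have hβ : ∀ s : Iic (0 : ℝ), ‖max 0 (min 1 ((s : ℝ) + S + 1)) • freeze S y s‖ ≤ B := fun s => by
    have h1 : ‖freeze S y s‖ ≤ B := by
      rcases le_total (-S) (s : ℝ) with hs | hs
      · rw [freeze_apply_of_ge y hs]; exact hB s hs
      · rw [freeze_apply_of_le hS y hs]; exact hB _ le_rfl
    rw [norm_smul, Real.norm_of_nonneg (le_max_left _ _)]
    calc _ ≤ 1 * B := mul_le_mul (max_le zero_le_one (min_le_left _ _)) h1 (norm_nonneg _)
          zero_le_one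
      _ = B := one_mul B
  refine ⟨BoundedContinuousFunction.ofNormedAddCommGroup
    (fun s : Iic (0 : ℝ) => max 0 (min 1 ((s : ℝ) + S + 1)) • freeze S y s)
    (by fun_prop) B hβ, fun s hs => ?_, ?_, fun s hs => ?_⟩
  · change max 0 (min 1 ((s : ℝ) + S + 1)) • freeze S y s = 0
    rw [max_eq_left ((min_le_right _ _).trans (by linarith)), zero_smul]
  · exact (BoundedContinuousFunction.norm_le hB0).2 hβ
  · change max 0 (min 1 ((s : ℝ) + S + 1)) • freeze S y s = y s
    rw [min_eq_left (by linarith), max_eq_right zero_le_one, one_smul, freeze_apply_of_ge y hs]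

namespace IsAdmissible

variable [CompactSpace Ω]

/-! ### Initial value problems -/

theorem exists_hat_bijective_of_nonneg (h : IsAdmissible φ D) {S : ℝ} (hS : 0 ≤ S) :
    ∃ K : ℝ, 0 ≤ K ∧ ∀ ω, (∀ u, VanishesBefore S u → ‖u‖ ≤ K * ‖h.hat ω u‖) ∧
      ∀ y, VanishesBefore S y → ∃ u, VanishesBefore S u ∧ h.hat ω u = y := by
  obtain ⟨r, hr, hn⟩ := h.exists_hat_bijective
  obtain ⟨n, hSn⟩ := exists_nat_ge (S / r)
  rw [div_le_iff₀ hr] at hSn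
  obtain ⟨K, hK, hb⟩ := hn n
  refine ⟨K, hK, fun ω => ⟨fun u hu => (hb ω).1 u (hu.mono hSn), fun y hy => ?_⟩⟩
  obtain ⟨u, hu, huy⟩ := (hb ω).2 y (hy.mono hSn)
  refine ⟨u, (vanishesBefore_iff_shift_eq_zero hS).2 ?_, huy⟩
  -- The solution found vanishes a priori only before `-nr`; its translate by `-S` has zero image
  -- and is therefore zero.
  have h1 := (hb (φ (past S hS : ℝ) ω)).1 _ (hu.shift (past S hS))
  rwa [← shift_hat, huy, (vanishesBefore_iff_shift_eq_zero hS).1 hy, norm_zero, mul_zero,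
    norm_le_zero_iff] at h1

/-- Uniqueness for the initial value problem started at time `-S`. -/
theorem eq_of_hat_eq (h : IsAdmissible φ D) {S : ℝ} (hS : 0 ≤ S) {ω : Ω} {u v : BC m}
    (h0 : shift u (past S hS) = shift v (past S hS))
    (h1 : ∀ s : Iic (0 : ℝ), -S ≤ (s : ℝ) → h.hat ω u s = h.hat ω v s) : u = v := by
  obtain ⟨K, -, hK⟩ := h.exists_hat_bijective_of_nonneg hS
  have hv : VanishesBefore S (u - v) := (vanishesBefore_iff_shift_eq_zero hS).2 (by
    rw [shift_sub, h0, sub_self])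
  have hz : h.hat ω (u - v) = 0 := by
    ext1 s
    rcases le_total (-S) (s : ℝ) with hs | hs
    · rw [map_sub]
      exact sub_eq_zero.2 (h1 s hs)
    · exact hv.hat hS h ω s hs
  have h2 := (hK ω).1 _ hv
  rw [hz, norm_zero, mul_zero, norm_le_zero_iff] at h2
  exact sub_eq_zero.1 h2

theorem exists_homogeneous_extension (h : IsAdmissible φ D) {S : ℝ} (hS : 0 ≤ S) {ω : Ω}
    {ϕ : BC m} (h0 : D (φ (-S) ω) ϕ = 0) : ∃ w : BC m, shift w (past S hS) = ϕ ∧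
      ∀ s : Iic (0 : ℝ), -S ≤ (s : ℝ) → h.hat ω w s = 0 := by
  obtain ⟨K, -, hK⟩ := h.exists_hat_bijective_of_nonneg hS
  -- The frozen value is `D(ω·(-S), ϕ)`, which vanishes by assumption. Subtracting the solution `u`
  -- below cancels the image of the constant continuation on `[-S, 0]`.
  have hy : VanishesBefore S (freeze S (h.hat ω (delay S ϕ))) := fun s hs => by
    rw [freeze_apply_of_le hS _ hs, hat_apply, shift_delay]
    exact h0
  obtain ⟨u, hu, huy⟩ := (hK ω).2 _ hy
  refine ⟨delay S ϕ - u, ?_, fun s hs => ?_⟩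
  · rw [shift_sub, shift_delay, (vanishesBefore_iff_shift_eq_zero hS).1 hu, sub_zero]
  · rw [map_sub, huy]
    exact sub_eq_zero.2 (freeze_apply_of_ge _ hs).symm

/-- The homogeneous equation `D(ω·t, x_t) = 0` has global solutions. -/
theorem exists_homogeneous_solution (h : IsAdmissible φ D) {ω : Ω} {ϕ : BC m} (h0 : D ω ϕ = 0) :
    ∃ x : ℝ → E m, Continuous x ∧ (∀ s : Iic (0 : ℝ), x s = ϕ s) ∧
      ∀ (t : ℝ) (ht : 0 ≤ t), shift (segment x t) (past t ht) = ϕ ∧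
        ∀ s : Iic (0 : ℝ), -t ≤ (s : ℝ) → h.hat (φ t ω) (segment x t) s = 0 := by
  have hex : ∀ t : ℝ, ∃ w : BC m, ∀ ht : 0 ≤ t, shift w (past t ht) = ϕ ∧
      ∀ s : Iic (0 : ℝ), -t ≤ (s : ℝ) → h.hat (φ t ω) w s = 0 := fun t => by
    by_cases ht : 0 ≤ t
    · obtain ⟨w, hw⟩ := h.exists_homogeneous_extension ht (ω := φ t ω) (ϕ := ϕ) (by
        rwa [← Flow.map_add, neg_add_cancel, Flow.map_zero_apply])
      exact ⟨w, fun _ => hw⟩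
    · exact ⟨0, fun h => absurd h ht⟩
  choose w hw using hex
  have hw0 : w 0 = ϕ := by
    rw [← (hw 0 le_rfl).1]
    ext1 s
    exact (w 0).congr_apply (by simp)
  -- `w t` is the solution up to time `t`, placed so that `t` sits at `0`. By uniqueness these
  -- pieces are compatible and glue to `x`.
  let x : ℝ → E m := fun t => w (max t 0) ⟨min t 0, min_mem_Iic t⟩
  have hx : ∀ T : ℝ, 0 ≤ T → ∀ s : Iic (0 : ℝ), x (T + s) = w T s := fun T hT s => by
    rcases le_total 0 (T + (s : ℝ)) with h1 | h1
    · have h2 : w (T + s) = shift (w T) s := by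
        refine h.eq_of_hat_eq h1 (ω := φ (T + s) ω) ?_ fun r hr => ?_
        · rw [(hw _ h1).1, shift_shift, ← (hw T hT).1]
          congr 1
          exact Subtype.ext (by simp)
        · rw [(hw _ h1).2 r hr, add_comm T, Flow.map_add, ← shift_hat, shift_apply,
            (hw T hT).2 _ (by simp only; linarith)]
      simp only [x, max_eq_left h1]
      rw [h2]
      exact (w T).congr_apply (by simp [h1])
    · simp only [x, max_eq_right h1]
      rw [hw0, ← (hw T hT).1]
      exact (w T).congr_apply (by simp [h1])
  have hseg : ∀ T : ℝ, 0 ≤ T → segment x T = w T := fun T hT => segment_eq (hx T hT)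
  refine ⟨x, ?_, fun s => ?_, fun t ht => ?_⟩
  · refine continuous_iff_continuousAt.2 fun t => ?_
    set T := max t 0 + 1 with hT
    have hT0 : 0 ≤ T := by positivity
    have htT : t < T := by linarith [le_max_left t 0]
    have hc : Continuous fun τ : ℝ => w T ⟨min (τ - T) 0, min_mem_Iic _⟩ :=
      (w T).continuous.comp (Continuous.subtype_mk (by fun_prop) _)
    refine hc.continuousAt.congr ?_
    filter_upwards [Iio_mem_nhds htT] with τ hτ
    have h1 : min (τ - T) 0 = τ - T := min_eq_left (by linarith [mem_Iio.1 hτ])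
    rw [← hx T hT0]
    simp [h1]
  · have := hx 0 le_rfl s
    rwa [zero_add, hw0] at this
  · rw [hseg t ht]
    exact hw t ht

/-! ### The stability estimate -/

/-- If `D̂₂(ω, x)` is small on `[t - S, t]`, then `x(t)` is bounded by a small multiple of the norm
of `x` and by a multiple of the bound for `D̂₂(ω, x)`. -/
theorem exists_stability_estimate (h : IsAdmissible φ D) : ∃ c : ℝ → ℝ, Tendsto c atTop (𝓝 0) ∧
    (∀ S, 0 ≤ c S) ∧ ∀ S : ℝ, 0 ≤ S → ∃ C : ℝ, 0 ≤ C ∧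
      ∀ (ω : Ω) (x : BC m) (t : Iic (0 : ℝ)) (B : ℝ),
        (∀ s : Iic (0 : ℝ), (t : ℝ) - S ≤ s → s ≤ t → ‖h.hat ω x s‖ ≤ B) →
        ‖x t‖ ≤ c S * ‖x‖ + C * B := by
  obtain ⟨c, -, hc, hst⟩ := h.stable
  refine ⟨fun S => |c S|, by simpa using hc.abs, fun S => abs_nonneg _, fun S hS => ?_⟩
  have hS1 : 0 ≤ S + 1 := by linarith
  obtain ⟨K, hK, hb⟩ := h.exists_hat_bijective_of_nonneg hS1
  -- By uniqueness `u` is the time-`S` segment of the homogeneous solution starting from its own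
  -- translate, so stability bounds its endpoint.
  have hom : ∀ (ω : Ω) (u : BC m), (∀ s : Iic (0 : ℝ), -S ≤ (s : ℝ) → h.hat ω u s = 0) →
      ‖u origin‖ ≤ |c S| * ‖u‖ := fun ω u hu => by
    have h0 : D (φ (-S) ω) (shift u (past S hS)) = 0 := hu (past S hS) le_rfl
    obtain ⟨x, hxc, hx0, hx⟩ := h.exists_homogeneous_solution h0
    have h1 : segment x S = u := by
      refine h.eq_of_hat_eq hS (ω := ω) (hx S hS).1 fun s hs => ?_
      have := (hx S hS).2 s hs
      rw [flow_neg_add] at this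
      rw [this, hu s hs]
    have h2 : x S = u origin := by
      rw [← h1, segment_apply_of_continuousOn hxc.continuousOn hx0 le_rfl]
      simp
    rw [← h2]
    refine (hst _ _ h0 x hxc hx0 (fun t ht => ?_) S hS).trans ?_
    · rw [← h.hat_apply_origin]
      exact (hx t ht).2 origin (by simpa using ht)
    · exact mul_le_mul (le_abs_self _) (norm_shift_le _ _) (norm_nonneg _) (abs_nonneg _)
  have hzero : ∀ (ω : Ω) (x : BC m) (B : ℝ),
      (∀ s : Iic (0 : ℝ), -S ≤ (s : ℝ) → ‖h.hat ω x s‖ ≤ B) →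
      ‖x origin‖ ≤ |c S| * ‖x‖ + K * (1 + |c S|) * B := fun ω x B hB => by
    -- `v` accounts for the image of `x` on `[-S, 0]`, leaving `x - v` homogeneous there. The
    -- cut-off needs one extra unit of time, hence `K` is taken for `S + 1`.
    obtain ⟨y, hyv, hyB, hy⟩ := exists_cutoff hS _ hB
    obtain ⟨v, hv, hvy⟩ := (hb ω).2 y hyv
    have h1 : ‖v‖ ≤ K * B := ((hb ω).1 v hv).trans
      (mul_le_mul_of_nonneg_left (by rwa [hvy]) hK)
    have h2 := hom ω (x - v) fun s hs => by
      rw [map_sub, hvy]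
      exact sub_eq_zero.2 (hy s hs).symm
    have h3 : ‖x origin‖ ≤ ‖(x - v) origin‖ + ‖v origin‖ := by
      simpa using norm_add_le ((x - v) origin) (v origin)
    have h4 := mul_le_mul_of_nonneg_left ((norm_sub_le x v).trans (add_le_add le_rfl h1))
      (abs_nonneg (c S))
    have h5 := (v.norm_coe_le_norm origin).trans h1
    linarith
  refine ⟨K * (1 + |c S|), by positivity, fun ω x t B hB => ?_⟩
  have h1 := hzero (φ (t : ℝ) ω) (shift x t) B fun s hs => by
    rw [← shift_hat, shift_apply]
    exact hB _ (by simp only; linarith) (Subtype.mk_le_mk.2 (by linarith [coe_nonpos s]))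
  rw [shift_apply_origin] at h1
  exact h1.trans (add_le_add (mul_le_mul_of_nonneg_left (norm_shift_le _ _) (abs_nonneg _)) le_rfl)

/-- With `c S < 1/2` the term in `‖x‖` is absorbed on the left. -/
theorem exists_norm_le_hat (h : IsAdmissible φ D) :
    ∃ C : ℝ, 0 ≤ C ∧ ∀ ω x, ‖x‖ ≤ C * ‖h.hat ω x‖ := by
  obtain ⟨c, hc, -, hest⟩ := h.exists_stability_estimate
  obtain ⟨S, hcS, hS⟩ := ((hc.eventually (gt_mem_nhds (one_half_pos (α := ℝ)))).and
    (eventually_ge_atTop 0)).exists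
  obtain ⟨C, hC, hb⟩ := hest S hS
  refine ⟨2 * C, by positivity, fun ω x => ?_⟩
  have h1 : ‖x‖ ≤ 1 / 2 * ‖x‖ + C * ‖h.hat ω x‖ :=
    (BoundedContinuousFunction.norm_le (by positivity)).2 fun t =>
      (hb ω x t ‖h.hat ω x‖ fun s _ _ => (h.hat ω x).norm_coe_le_norm s).trans
        (add_le_add (mul_le_mul_of_nonneg_right hcS.le (norm_nonneg _)) le_rfl)
  linarith

theorem hat_injective (h : IsAdmissible φ D) (ω : Ω) : Function.Injective (h.hat ω) := by
  obtain ⟨C, -, hC⟩ := h.exists_norm_le_hat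
  refine (injective_iff_map_eq_zero _).2 fun x hx => ?_
  have := hC ω x
  rwa [hx, norm_zero, mul_zero, norm_le_zero_iff] at this

end IsAdmissible

/-! ### Limits in the compact-open topology -/

/-- A locally uniform limit of a bounded sequence in `BC`. -/
theorem exists_tendsto_coDist_of_locallyUniform {x : ℕ → BC m} {C : ℝ} (hC : 0 ≤ C)
    (hb : ∀ n, ‖x n‖ ≤ C)
    (hx : ∀ (N : ℕ) (η : ℝ), 0 < η → ∃ n₀ : ℕ, ∀ k ≥ n₀, ∀ n ≥ n₀, ∀ s : Iic (0 : ℝ),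
      -(N : ℝ) ≤ (s : ℝ) → ‖x k s - x n s‖ ≤ η) :
    ∃ y : BC m, ‖y‖ ≤ C ∧ Tendsto (fun n => coDist (x n) y) atTop (𝓝 0) := by
  have hN : ∀ s : Iic (0 : ℝ), ∃ N : ℕ, -(N : ℝ) < (s : ℝ) := fun s => by
    obtain ⟨N, hN⟩ := exists_nat_gt (-(s : ℝ))
    exact ⟨N, by linarith⟩
  have hlim : ∀ s, ∃ y : E m, Tendsto (fun n => x n s) atTop (𝓝 y) := fun s => by
    refine cauchySeq_tendsto_of_complete (Metric.cauchySeq_iff'.2 fun ε hε => ?_)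
    obtain ⟨N, hN⟩ := hN s
    obtain ⟨n₀, hn₀⟩ := hx N (ε / 2) (half_pos hε)
    refine ⟨n₀, fun n hn => ?_⟩
    rw [dist_eq_norm]
    exact (hn₀ n hn n₀ le_rfl s hN.le).trans_lt (half_lt_self hε)
  choose f hf using hlim
  have hunif : ∀ (N : ℕ) (η : ℝ), 0 < η → ∃ n₀ : ℕ, ∀ n ≥ n₀, ∀ s : Iic (0 : ℝ),
      -(N : ℝ) ≤ (s : ℝ) → ‖x n s - f s‖ ≤ η := fun N η hη => by
    obtain ⟨n₀, hn₀⟩ := hx N η hη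
    refine ⟨n₀, fun n hn s hs => ?_⟩
    refine le_of_tendsto ((tendsto_const_nhds (x := x n s)).sub (hf s)).norm ?_
    filter_upwards [eventually_ge_atTop n₀] with k hk using hn₀ n hn k hk s hs
  have hfc : Continuous f := by
    refine TendstoLocallyUniformly.continuous (F := fun n s => x n s) (p := atTop) ?_
      (Frequently.of_forall fun n => (x n).continuous)
    refine Metric.tendstoLocallyUniformly_iff.2 fun ε hε s => ?_
    obtain ⟨N, hN⟩ := hN s
    obtain ⟨n₀, hn₀⟩ := hunif N (ε / 2) (half_pos hε)
    refine ⟨{r | -(N : ℝ) < (r : ℝ)}, (isOpen_lt continuous_const continuous_subtype_val).mem_nhds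
      hN, ?_⟩
    filter_upwards [eventually_ge_atTop n₀] with n hn r hr
    rw [dist_comm, dist_eq_norm]
    exact (hn₀ n hn r (le_of_lt hr)).trans_lt (half_lt_self hε)
  have hfC : ∀ s, ‖f s‖ ≤ C := fun s => le_of_tendsto (hf s).norm
    (.of_forall fun n => ((x n).norm_coe_le_norm s).trans (hb n))
  refine ⟨BoundedContinuousFunction.ofNormedAddCommGroup f hfc C hfC,
    (BoundedContinuousFunction.norm_le hC).2 hfC, tendsto_coDist_zero fun N η hη => ?_⟩
  obtain ⟨n₀, hn₀⟩ := hunif N η hη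
  filter_upwards [eventually_ge_atTop n₀] with n hn s hs using hn₀ n hn s hs

theorem tendsto_coDist_shift_of_tendsto {x : ℕ → BC m} {y : BC m}
    (h : Tendsto (fun n => coDist (x n) y) atTop (𝓝 0)) (s : Iic (0 : ℝ)) :
    Tendsto (fun n => coDist (shift (x n) s) (shift y s)) atTop (𝓝 0) := by
  refine tendsto_coDist_zero fun N η hη => ?_
  obtain ⟨N', hN'⟩ := exists_nat_ge (N - (s : ℝ))
  filter_upwards [eventually_norm_sub_lt_of_tendsto_coDist h N' hη] with n hn r hr
  exact (hn _ (by change -(N' : ℝ) ≤ (s : ℝ) + r; linarith)).le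

namespace IsAdmissible

variable [CompactSpace Ω]

/-! ### Invertibility of `D̂` -/

/-- Cut-offs of `y` have preimages, uniformly bounded by the lower bound for `D̂₂`. Differences of
preimages have zero image on long intervals, so the stability estimate with `B = 0` makes the
sequence locally uniformly Cauchy; (D2) identifies the image of the limit. -/
theorem hat_surjective (h : IsAdmissible φ D) (ω : Ω) : Function.Surjective (h.hat ω) := by
  intro y
  obtain ⟨C, hC, hlow⟩ := h.exists_norm_le_hat
  obtain ⟨c, hc, hc0, hest⟩ := h.exists_stability_estimate
  have happ : ∀ n : ℕ, ∃ x : BC m, ‖x‖ ≤ C * ‖y‖ ∧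
      ∀ s : Iic (0 : ℝ), -(n : ℝ) ≤ (s : ℝ) → h.hat ω x s = y s := fun n => by
    obtain ⟨y', hv, hn, hy⟩ := exists_cutoff (Nat.cast_nonneg n) y fun s _ => y.norm_coe_le_norm s
    obtain ⟨K, -, hK⟩ := h.exists_hat_bijective_of_nonneg (S := (n : ℝ) + 1) (by positivity)
    obtain ⟨x, -, hx⟩ := (hK ω).2 y' hv
    refine ⟨x, (hlow ω x).trans ?_, fun s hs => by rw [hx, hy s hs]⟩
    rw [hx]
    exact mul_le_mul_of_nonneg_left hn hC
  choose x hxb hx using happ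
  have hR : 0 ≤ C * ‖y‖ := by positivity
  obtain ⟨z, hz, hlim⟩ := exists_tendsto_coDist_of_locallyUniform hR hxb fun N η hη => by
    have hη' : 0 < η / (2 * (C * ‖y‖) + 1) := by positivity
    obtain ⟨S, hcS, hS⟩ := ((hc.eventually (gt_mem_nhds hη')).and (eventually_ge_atTop 0)).exists
    -- At times in `[-N, 0]` the stability estimate looks back as far as `-(N + S)`.
    obtain ⟨n₀, hn₀⟩ := exists_nat_ge (N + S)
    obtain ⟨C', -, hb⟩ := hest S hS
    refine ⟨n₀, fun k hk n hn s hs => ?_⟩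
    have hk' : (n₀ : ℝ) ≤ k := by exact_mod_cast hk
    have hn' : (n₀ : ℝ) ≤ n := by exact_mod_cast hn
    have h1 := hb ω (x k - x n) s 0 fun r hr _ => by
      rw [map_sub, BoundedContinuousFunction.sub_apply, hx k r (by linarith),
        hx n r (by linarith), sub_self, norm_zero]
    have h2 : ‖x k - x n‖ ≤ 2 * (C * ‖y‖) := by
      linarith [norm_sub_le (x k) (x n), hxb k, hxb n]
    have h3 : c S * ‖x k - x n‖ ≤ η := by
      calc c S * ‖x k - x n‖ ≤ η / (2 * (C * ‖y‖) + 1) * (2 * (C * ‖y‖) + 1) :=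
            mul_le_mul hcS.le (by linarith) (norm_nonneg _) hη'.le
        _ = η := div_mul_cancel₀ _ (by positivity)
    rw [mul_zero, add_zero] at h1
    exact h1.trans h3
  refine ⟨z, ?_⟩
  ext1 s
  have h1 : Tendsto (fun n => h.hat ω (x n) s) atTop (𝓝 (h.hat ω z s)) :=
    h.compactOpenRegular (C * ‖y‖ + 1) (by positivity) (fun _ => φ (s : ℝ) ω) _
      (fun n => shift (x n) s) (shift z s)
      (fun n => ((norm_shift_le _ _).trans (hxb n)).trans (by linarith))
      (((norm_shift_le _ _).trans hz).trans (by linarith)) tendsto_const_nhds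
      (tendsto_coDist_shift_of_tendsto hlim s)
  refine tendsto_nhds_unique h1 (tendsto_const_nhds.congr' ?_)
  obtain ⟨N, hN⟩ := exists_nat_ge (-(s : ℝ))
  filter_upwards [eventually_ge_atTop N] with n hn
  have : (N : ℝ) ≤ n := by exact_mod_cast hn
  exact (hx n s (by linarith)).symm

/-- The operator `D̂₂(ω, ·)` as a bijection of `BC`. -/
noncomputable def hatEquiv (h : IsAdmissible φ D) (ω : Ω) : BC m ≃ BC m :=
  Equiv.ofBijective (h.hat ω) ⟨h.hat_injective ω, h.hat_surjective ω⟩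

/-- The inverse of `D̂₂(ω, ·)`. -/
noncomputable def inv (h : IsAdmissible φ D) (ω : Ω) (x : BC m) : BC m := (h.hatEquiv ω).symm x

@[simp]
theorem hat_inv (h : IsAdmissible φ D) (ω : Ω) (x : BC m) : h.hat ω (h.inv ω x) = x :=
  (h.hatEquiv ω).apply_symm_apply x

@[simp]
theorem inv_hat (h : IsAdmissible φ D) (ω : Ω) (x : BC m) : h.inv ω (h.hat ω x) = x :=
  (h.hatEquiv ω).symm_apply_apply x

theorem inv_sub (h : IsAdmissible φ D) (ω : Ω) (x y : BC m) :
    h.inv ω (x - y) = h.inv ω x - h.inv ω y :=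
  h.hat_injective ω (by rw [map_sub, hat_inv, hat_inv, hat_inv])

theorem shift_inv (h : IsAdmissible φ D) (ω : Ω) (x : BC m) (s : Iic (0 : ℝ)) :
    shift (h.inv ω x) s = h.inv (φ (s : ℝ) ω) (shift x s) :=
  h.hat_injective (φ (s : ℝ) ω) (by rw [← shift_hat, hat_inv, hat_inv])

theorem apply_inv (h : IsAdmissible φ D) (ω : Ω) (x : BC m) : D ω (h.inv ω x) = x origin := by
  rw [← h.hat_apply_origin, hat_inv]

theorem dHat₂_inv (h : IsAdmissible φ D) (ω : Ω) (x : BC m) : dHat₂ φ D ω (h.inv ω x) = x := by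
  rw [← h.coe_hat, hat_inv]

theorem exists_norm_inv_le (h : IsAdmissible φ D) :
    ∃ C : ℝ, 0 ≤ C ∧ ∀ ω x, ‖h.inv ω x‖ ≤ C * ‖x‖ := by
  obtain ⟨C, hC, hlow⟩ := h.exists_norm_le_hat
  exact ⟨C, hC, fun ω x => by simpa using hlow ω (h.inv ω x)⟩

/-- Uniform continuity at zero, on balls, of the operators `D̂₂(ω, ·)⁻¹` for the compact-open
topology. -/
theorem exists_norm_inv_apply_le (h : IsAdmissible φ D) (R : ℝ) (N : ℕ) {η : ℝ} (hη : 0 < η) :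
    ∃ N' : ℕ, ∃ B : ℝ, 0 < B ∧ ∀ (ω : Ω) (x : BC m), ‖x‖ ≤ R →
      (∀ s : Iic (0 : ℝ), -(N' : ℝ) ≤ (s : ℝ) → ‖h.hat ω x s‖ ≤ B) →
      ∀ s : Iic (0 : ℝ), -(N : ℝ) ≤ (s : ℝ) → ‖x s‖ ≤ η := by
  obtain ⟨c, hc, hc0, hest⟩ := h.exists_stability_estimate
  have hη' : 0 < η / 2 / (|R| + 1) := by positivity
  obtain ⟨S, hcS, hS⟩ := ((hc.eventually (gt_mem_nhds hη')).and (eventually_ge_atTop 0)).exists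
  obtain ⟨C, hC, hb⟩ := hest S hS
  obtain ⟨N', hN'⟩ := exists_nat_ge (N + S)
  refine ⟨N', η / 2 / (C + 1), by positivity, fun ω x hx hB s hs => ?_⟩
  have h1 := hb ω x s _ fun r hr _ => hB r (by linarith)
  have h2 : c S * ‖x‖ ≤ η / 2 := by
    calc c S * ‖x‖ ≤ η / 2 / (|R| + 1) * (|R| + 1) :=
          mul_le_mul hcS.le (by linarith [le_abs_self R]) (norm_nonneg _) hη'.le
      _ = η / 2 := div_mul_cancel₀ _ (by positivity)
  have h3 : C * (η / 2 / (C + 1)) ≤ η / 2 := by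
    calc C * (η / 2 / (C + 1)) ≤ (C + 1) * (η / 2 / (C + 1)) :=
          mul_le_mul_of_nonneg_right (by linarith) (by positivity)
      _ = η / 2 := mul_div_cancel₀ _ (by positivity)
  linarith

/-- Continuity of `D̂₂(ω, x)` in `ω` for the compact-open topology. -/
theorem eventually_norm_hat_sub_lt (h : IsAdmissible φ D) (x : BC m) (ω : Ω) (N : ℕ) {η : ℝ}
    (hη : 0 < η) : ∀ᶠ ω' in 𝓝 ω, ∀ s : Iic (0 : ℝ), -(N : ℝ) ≤ (s : ℝ) →
      ‖h.hat ω' x s - h.hat ω x s‖ < η := by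
  let f : C(Ω × Icc (-(N : ℝ)) 0, E m) :=
    ⟨fun p => dHat₂ φ D p.1 x ⟨p.2, mem_Iic.2 p.2.2.2⟩,
      (h.continuous_dHat₂_uncurry x).comp (continuous_fst.prodMk
        (Continuous.subtype_mk (by fun_prop) _))⟩
  filter_upwards [f.curry.continuous.tendsto ω (Metric.ball_mem_nhds _ hη)] with ω' hω' s hs
  have h2 := (ContinuousMap.dist_apply_le_dist (f := f.curry ω') (g := f.curry ω)
    ⟨s, hs, coe_nonpos s⟩).trans_lt hω'
  rwa [dist_eq_norm] at h2

/-- Applying `D̂₂(ω' n, ·)` to the difference of the inverses gives `x' n - D̂₂(ω' n, D̂₂(ω, ·)⁻¹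
x)`. Both terms approach `x` on compact intervals, and the uniform estimate for the inverse
concludes. -/
theorem tendsto_coDist_inv (h : IsAdmissible φ D) {r : ℝ} {ω' : ℕ → Ω} {ω : Ω}
    {x' : ℕ → BC m} {x : BC m} (hx' : ∀ n, ‖x' n‖ ≤ r) (hx : ‖x‖ ≤ r)
    (hω : Tendsto ω' atTop (𝓝 ω)) (hc : Tendsto (fun n => coDist (x' n) x) atTop (𝓝 0)) :
    Tendsto (fun n => coDist (h.inv (ω' n) (x' n)) (h.inv ω x)) atTop (𝓝 0) := by
  obtain ⟨C, hC, hinv⟩ := h.exists_norm_inv_le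
  refine tendsto_coDist_zero fun N η hη => ?_
  obtain ⟨N', B, hB, hb⟩ := h.exists_norm_inv_apply_le (2 * (C * r)) N hη
  filter_upwards [eventually_norm_sub_lt_of_tendsto_coDist hc N' (half_pos hB),
    hω.eventually (h.eventually_norm_hat_sub_lt (h.inv ω x) ω N' (half_pos hB))] with n h1 h2
  refine hb (ω' n) (h.inv (ω' n) (x' n) - h.inv ω x) ?_ fun s hs => ?_
  · have h3 := (hinv (ω' n) (x' n)).trans (mul_le_mul_of_nonneg_left (hx' n) hC)
    have h4 := (hinv ω x).trans (mul_le_mul_of_nonneg_left hx hC)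
    linarith [norm_sub_le (h.inv (ω' n) (x' n)) (h.inv ω x)]
  · have h3 := h1 s hs
    have h4 := h2 s hs
    rw [hat_inv, norm_sub_rev] at h4
    rw [map_sub, hat_inv, BoundedContinuousFunction.sub_apply]
    have h5 := norm_sub_le_norm_sub_add_norm_sub (x' n s) (x s) (h.hat (ω' n) (h.inv ω x) s)
    linarith

/-! ### Regularity and monotonicity of the transformed vector field -/

theorem compactOpenRegular_comp_inv (h : IsAdmissible φ D) {G : Ω × BC m → E m}
    (hG : CompactOpenRegular G) :
    CompactOpenRegular fun p : Ω × BC m => G (p.1, h.inv p.1 p.2) := by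
  obtain ⟨C, hC, hinv⟩ := h.exists_norm_inv_le
  intro r hr ω' ω x' x hx' hx hω hc
  have hball : ∀ ω y, y ∈ ball m r → h.inv ω y ∈ ball m (C * r + 1) := fun ω y hy =>
    ((hinv ω y).trans (mul_le_mul_of_nonneg_left hy hC)).trans (by linarith)
  exact hG (C * r + 1) (by positivity) ω' ω _ _ (fun n => hball _ _ (hx' n)) (hball _ _ hx) hω
    (h.tendsto_coDist_inv hx' hx hω hc)

/-- Continuity of the inverse in `ω` is known only for the compact-open topology. Norm continuity
still follows, since a norm-convergent sequence is bounded and converges for `coDist`. -/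
theorem normRegular_comp_inv (h : IsAdmissible φ D) {G : Ω × BC m → E m}
    (hG : NormRegular G) (hG' : CompactOpenRegular G) :
    NormRegular fun p : Ω × BC m => G (p.1, h.inv p.1 p.2) := by
  obtain ⟨C, hC, hinv⟩ := h.exists_norm_inv_le
  refine ⟨SeqContinuous.continuous fun p' p hp => ?_, fun r hr => ?_⟩
  · have h1 : Tendsto (fun n => (p' n).1) atTop (𝓝 p.1) := (continuous_fst.tendsto p).comp hp
    have h2 : Tendsto (fun n => (p' n).2) atTop (𝓝 p.2) := (continuous_snd.tendsto p).comp hp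
    obtain ⟨R, hR⟩ := (Metric.isBounded_range_of_tendsto _ h2).exists_norm_le
    refine h.compactOpenRegular_comp_inv hG' (max R 0 + ‖p.2‖ + 1) (by positivity)
      (fun n => (p' n).1) p.1 (fun n => (p' n).2) p.2 (fun n => ?_) ?_ h1 ?_
    · refine (hR _ (mem_range_self n)).trans ?_
      linarith [le_max_left R 0, norm_nonneg p.2]
    · change ‖p.2‖ ≤ _
      linarith [le_max_right R 0]
    · refine tendsto_coDist_zero fun N η hη => ?_
      filter_upwards [h2 (Metric.ball_mem_nhds _ hη)] with n hn s _
      rw [← dist_eq_norm]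
      exact (BoundedContinuousFunction.dist_coe_le_dist s).trans (le_of_lt hn)
  · obtain ⟨L, hL⟩ := hG.2 (C * r + 1) (by positivity)
    refine ⟨L * C.toNNReal, fun ω => LipschitzOnWith.of_dist_le_mul fun x hx y hy => ?_⟩
    have hball : ∀ y, y ∈ ball m r → h.inv ω y ∈ ball m (C * r + 1) := fun y hy =>
      ((hinv ω y).trans (mul_le_mul_of_nonneg_left hy hC)).trans (by linarith)
    refine ((hL ω).dist_le_mul _ (hball x hx) _ (hball y hy)).trans ?_
    rw [NNReal.coe_mul, Real.coe_toNNReal C hC, mul_assoc, dist_eq_norm, dist_eq_norm, ← inv_sub]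
    exact mul_le_mul_of_nonneg_left (hinv ω _) L.coe_nonneg

theorem quasimonotone_comp_inv (h : IsAdmissible φ D) {a : Fin m → ℝ} {G : Ω × BC m → E m}
    (hG : NeutralQuasimonotone φ D a G) :
    Quasimonotone a fun p : Ω × BC m => G (p.1, h.inv p.1 p.2) := fun ω x y hxy => by
  have h1 := hG ω (h.inv ω x) (h.inv ω y) (by rwa [TransformedLE, dHat₂_inv, dHat₂_inv])
  rwa [apply_inv, apply_inv] at h1

end IsAdmissible

/-! ### Transport of solutions -/

/-- The image of a function `z` under a family of maps `Φ(ω)` of `BC`: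
`t ↦ Φ(ω·t)(z_t)(0)`. -/
noncomputable def transport (φ : Flow ℝ Ω) (Φ : Ω → BC m → BC m) (ω : Ω) (z : ℝ → E m) (t : ℝ) :
    E m := Φ (φ t ω) (segment z t) origin

section Transport

variable {Φ : Ω → BC m → BC m}
  {z : ℝ → E m} {T : ℝ} {x : BC m} {ω : Ω}

/-- Since `Φ` commutes with translations, evaluating it along earlier segments reads off the whole
history of its value at the segment `z_t`. -/
theorem transport_add
    (hΦ : ∀ ω x s, shift (Φ ω x) s = Φ (φ (s : ℝ) ω) (shift x s))
    (hz : ContinuousOn z (Iic T)) (hx : ∀ s : Iic (0 : ℝ), z s = x s)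
    {t : ℝ} (ht : t ≤ T) (s : Iic (0 : ℝ)) :
    transport φ Φ ω z (t + s) = Φ (φ t ω) (segment z t) s := by
  rw [transport, ← shift_segment hz hx ht, add_comm t, Flow.map_add, ← hΦ, shift_apply_origin]

theorem segment_transport
    (hΦ : ∀ ω x s, shift (Φ ω x) s = Φ (φ (s : ℝ) ω) (shift x s))
    (hz : ContinuousOn z (Iic T)) (hx : ∀ s : Iic (0 : ℝ), z s = x s)
    {t : ℝ} (ht : t ≤ T) : segment (transport φ Φ ω z) t = Φ (φ t ω) (segment z t) :=
  segment_eq (transport_add hΦ hz hx ht)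

theorem transport_coe
    (hΦ : ∀ ω x s, shift (Φ ω x) s = Φ (φ (s : ℝ) ω) (shift x s))
    (hz : ContinuousOn z (Iic T)) (hx : ∀ s : Iic (0 : ℝ), z s = x s)
    (hT : 0 ≤ T) (s : Iic (0 : ℝ)) : transport φ Φ ω z s = Φ ω x s := by
  have h1 := transport_add hΦ hz hx hT (ω := ω) s
  rwa [zero_add, Flow.map_zero_apply, segment_zero_of_continuousOn hx] at h1

theorem continuousOn_transport
    (hΦ : ∀ ω x s, shift (Φ ω x) s = Φ (φ (s : ℝ) ω) (shift x s))
    (hz : ContinuousOn z (Iic T))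
    (hx : ∀ s : Iic (0 : ℝ), z s = x s) : ContinuousOn (transport φ Φ ω z) (Iic T) := by
  have hc : Continuous fun t : ℝ => Φ (φ T ω) (segment z T) ⟨min (t - T) 0, min_mem_Iic _⟩ :=
    (Φ (φ T ω) (segment z T)).continuous.comp (Continuous.subtype_mk (by fun_prop) _)
  refine hc.continuousOn.congr fun t ht => ?_
  have h1 : min (t - T) 0 = t - T := min_eq_left (by linarith [mem_Iic.1 ht])
  change _ = Φ (φ T ω) (segment z T) ⟨min (t - T) 0, min_mem_Iic _⟩
  rw [← transport_add hΦ hz hx le_rfl]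
  simp [h1]

end Transport

/-- A segment contains its own history: the solution leading from `ψ s` to `x` has `ψ s` as initial
part, so the orbit consists of translates of `x`. -/
theorem HasBackwardOrbit.eq_shift {F : Ω × BC m → E m}
    {x : BC m} {ω : Ω} {ψ : Iic (0 : ℝ) → Ω × BC m} (h0 : ψ origin = (ω, x))
    (hψ : ∀ s s' : Iic (0 : ℝ), s ≤ s' →
      (ψ s').1 = φ ((s' : ℝ) - (s : ℝ)) (ψ s).1 ∧
      Reaches (IsFDESol φ F) ((s' : ℝ) - (s : ℝ)) (ψ s).1 (ψ s).2 (ψ s').2) (s : Iic (0 : ℝ)) :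
    ψ s = (φ (s : ℝ) ω, shift x s) := by
  obtain ⟨h1, z, ⟨hzc, hz0, -⟩, hz⟩ := hψ s origin (coe_nonpos s)
  simp only [h0, origin_coe, zero_sub] at h1 hz hzc
  refine Prod.ext ?_ ?_
  · rw [h1]
    exact (flow_neg_add φ _ _).symm
  · change (ψ s).2 = shift x s
    rw [← hz, shift_segment hzc hz0 le_rfl, neg_add_cancel, segment_zero_of_continuousOn hz0]

namespace IsAdmissible

variable [CompactSpace Ω] {G : Ω × BC m → E m} {T : ℝ} {ω : Ω} {x : BC m} {z : ℝ → E m}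

/-- Along the transported function, `D` returns the original `z`, so both equations differentiate
the same function. -/
theorem isNFDESol_transport_inv (h : IsAdmissible φ D) (hT : 0 ≤ T)
    (hz : IsFDESol φ (fun p => G (p.1, h.inv p.1 p.2)) T ω x z) :
    IsNFDESol φ D G T ω (h.inv ω x) (transport φ h.inv ω z) := by
  obtain ⟨hc, hx, hd⟩ := hz
  refine ⟨continuousOn_transport h.shift_inv hc hx, transport_coe h.shift_inv hc hx hT,
    fun t ht => ?_⟩
  have hD : ∀ τ ∈ Icc 0 T, D (φ τ ω) (segment (transport φ h.inv ω z) τ) = z τ := fun τ hτ => by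
    rw [segment_transport h.shift_inv hc hx hτ.2, apply_inv,
      segment_apply_of_continuousOn hc hx hτ.2, origin_coe, add_zero]
  rw [segment_transport h.shift_inv hc hx ht.2]
  exact (hd t ht).congr hD (hD t ht)

theorem isFDESol_transport_hat (h : IsAdmissible φ D) (hT : 0 ≤ T)
    (hz : IsNFDESol φ D G T ω x z) :
    IsFDESol φ (fun p => G (p.1, h.inv p.1 p.2)) T ω (h.hat ω x)
      (transport φ (fun ω => h.hat ω) ω z) := by
  obtain ⟨hc, hx, hd⟩ := hz
  refine ⟨continuousOn_transport h.shift_hat hc hx, transport_coe h.shift_hat hc hx hT,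
    fun t ht => ?_⟩
  rw [segment_transport (Φ := fun ω => h.hat ω) h.shift_hat hc hx ht.2]
  simp only [inv_hat]
  exact (hd t ht).congr (fun τ _ => h.hat_apply_origin _ _) (h.hat_apply_origin _ _)

/-! ### Backward orbits and the separating property -/

/-- The translates of the inverse image form the orbit, so its continuity is that of translation. -/
theorem hasBackwardOrbit_inv (h : IsAdmissible φ D)
    (hx : HasBackwardOrbit φ (IsFDESol φ fun p => G (p.1, h.inv p.1 p.2)) ω x) :
    HasBackwardOrbit φ (IsNFDESol φ D G) ω (h.inv ω x) := by
  obtain ⟨ψ, -, -, h0, hψ⟩ := hx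
  have hsh := HasBackwardOrbit.eq_shift h0 hψ
  refine ⟨fun s => (φ (s : ℝ) ω, shift (h.inv ω x) s),
    φ.continuous continuous_subtype_val continuous_const,
    fun s₀ => tendsto_coDist_shift _ tendsto_id, by simp, fun s s' hs => ?_⟩
  have hφ : φ ((s' : ℝ) - s) (φ (s : ℝ) ω) = φ (s' : ℝ) ω := by
    rw [← Flow.map_add, sub_add_cancel]
  obtain ⟨-, z, hz, hzs⟩ := hψ s s' hs
  simp only [hsh] at hz hzs
  have hT : 0 ≤ (s' : ℝ) - s := sub_nonneg.2 hs
  refine ⟨hφ.symm, transport φ h.inv (φ (s : ℝ) ω) z, ?_, ?_⟩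
  · simp only [shift_inv]
    exact h.isNFDESol_transport_inv hT hz
  · rw [segment_transport h.shift_inv hz.1 hz.2.1 le_rfl, hzs, hφ]
    simp only [shift_inv]

theorem separating_comp_inv (h : IsAdmissible φ D) {a : Fin m → ℝ}
    (hG : NeutralSeparating φ D a G) :
    Separating φ a fun p : Ω × BC m => G (p.1, h.inv p.1 p.2) := fun ω x y hx hy hxy J hJ i hi => by
  have h1 := hG ω (h.inv ω x) (h.inv ω y) (h.hasBackwardOrbit_inv hx) (h.hasBackwardOrbit_inv hy)
    (by rwa [TransformedLE, dHat₂_inv, dHat₂_inv]) J (by rwa [dHat₂_inv, dHat₂_inv]) i hi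
  rwa [apply_inv, apply_inv] at h1

/-! ### Uniform stability -/

/-- Uniform continuity at zero, on balls, of the operators `D(ω, ·)` for the compact-open
topology. -/
theorem exists_norm_apply_le (h : IsAdmissible φ D) (R : ℝ) {η : ℝ} (hη : 0 < η) :
    ∃ N : ℕ, ∃ B : ℝ, 0 < B ∧ ∀ (ω : Ω) (u : BC m), ‖u‖ ≤ R →
      (∀ s : Iic (0 : ℝ), -(N : ℝ) ≤ (s : ℝ) → ‖u s‖ ≤ B) → ‖D ω u‖ ≤ η := by
  -- A failing sequence `u n` tends to `0` for `coDist` within a ball; along a subsequence with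
  -- convergent base points this contradicts (D2).
  by_contra! H
  choose ω u hu hB hD using fun n : ℕ => H n (1 / ((n : ℝ) + 1)) (by positivity)
  obtain ⟨ω₀, σ, hσ, hω⟩ := CompactSpace.tendsto_subseq ω
  have h1 := h.compactOpenRegular (|R| + 1) (by positivity) (ω ∘ σ) ω₀ (u ∘ σ) 0
    (fun n => (hu _).trans (by linarith [le_abs_self R]))
    (by change ‖(0 : BC m)‖ ≤ _; rw [norm_zero]; positivity) hω
    (tendsto_coDist_zero fun N ε hε => by
      filter_upwards [hσ.tendsto_atTop.eventually (eventually_ge_atTop N),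
        hσ.tendsto_atTop.eventually
          (tendsto_one_div_add_atTop_nhds_zero_nat.eventually (gt_mem_nhds hε))] with n h1 h2 s hs
      have h3 : (N : ℝ) ≤ σ n := by exact_mod_cast h1
      have h4 := (hB (σ n) s (by linarith)).trans h2.le
      simpa using h4)
  simp only [map_zero] at h1
  obtain ⟨n, hn⟩ := (h1.norm.eventually (gt_mem_nhds (by simpa using hη))).exists
  exact absurd hn (not_lt.2 (hD (σ n)).le)

theorem exists_norm_hat_apply_le (h : IsAdmissible φ D) (R : ℝ) (N : ℕ) {η : ℝ} (hη : 0 < η) :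
    ∃ N' : ℕ, ∃ B : ℝ, 0 < B ∧ ∀ (ω : Ω) (u : BC m), ‖u‖ ≤ R →
      (∀ s : Iic (0 : ℝ), -(N' : ℝ) ≤ (s : ℝ) → ‖u s‖ ≤ B) →
      ∀ s : Iic (0 : ℝ), -(N : ℝ) ≤ (s : ℝ) → ‖h.hat ω u s‖ ≤ η := by
  obtain ⟨N₁, B, hB, hb⟩ := h.exists_norm_apply_le R hη
  refine ⟨N₁ + N, B, hB, fun ω u hu hs s hsN => ?_⟩
  refine hb _ _ ((norm_shift_le _ _).trans hu) fun r hr => ?_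
  exact hs _ (by
    change -((N₁ + N : ℕ) : ℝ) ≤ (s : ℝ) + r
    push_cast
    linarith)

/-- The tolerances are chosen backwards from `ε`: through `D̂₂`, then neutral stability on a larger
ball, then the inverse. -/
theorem ballsStable_comp_inv (h : IsAdmissible φ D) {a : Fin m → ℝ}
    (hG : NeutralBallsStable φ D a G) :
    BallsStable φ a fun p : Ω × BC m => G (p.1, h.inv p.1 p.2) := by
  obtain ⟨C, hC, hinv⟩ := h.exists_norm_inv_le
  intro k ε hε
  obtain ⟨k', hk'⟩ := exists_nat_ge (C * k)
  obtain ⟨N, η, hη, hNη⟩ := exists_coDist_lt (m := m) hε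
  obtain ⟨N₁, B₁, hB₁, hhat⟩ := h.exists_norm_hat_apply_le (2 * k' + 1) N hη
  -- `B₁` serves the continuity of `D̂₂`; the bound `1` keeps the neutral solutions within a fixed
  -- distance, used in `hbound`.
  obtain ⟨ε', hε', hε'B⟩ := exists_forall_norm_sub_lt (m := m) N₁ (lt_min hB₁ one_pos)
  obtain ⟨δ', hδ', hst⟩ := hG k' ε' hε'
  obtain ⟨N₂, η₂, hη₂, hδ'N⟩ := exists_coDist_lt (m := m) hδ'
  obtain ⟨N₃, B₃, hB₃, hinvc⟩ := h.exists_norm_inv_apply_le (2 * k') N₂ hη₂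
  obtain ⟨δ, hδ, hδB⟩ := exists_forall_norm_sub_lt (m := m) N₃ hB₃
  have hball : ∀ (ω : Ω) (x : BC m), x ∈ ball m k → ‖h.inv ω x‖ ≤ k' := fun ω x hx =>
    ((hinv ω x).trans (mul_le_mul_of_nonneg_left hx hC)).trans hk'
  refine ⟨δ, hδ, fun ω x hx y hy hxy hR => ?_⟩
  have hd : coDist (h.inv ω x) (h.inv ω y) < δ' := by
    refine hδ'N _ _ (hinvc ω (h.inv ω x - h.inv ω y) ?_ fun s hs => ?_)
    · linarith [norm_sub_le (h.inv ω x) (h.inv ω y), hball ω x hx, hball ω y hy]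
    · rw [← inv_sub, hat_inv]
      exact (hδB x y hxy s hs).le
  obtain ⟨⟨z₀, hz₀⟩, ⟨w₀, hw₀⟩, hzw⟩ := hst ω (h.inv ω x) (hball ω x hx) (h.inv ω y)
    (hball ω y hy) hd (by simpa only [TransformedLE, dHat₂_inv] using hR)
  refine ⟨⟨transport φ (fun ω => h.hat ω) ω z₀, fun T hT => ?_⟩,
    ⟨transport φ (fun ω => h.hat ω) ω w₀, fun T hT => ?_⟩, fun z w hz hw t ht => ?_⟩
  · simpa using h.isFDESol_transport_hat hT (hz₀ T hT)
  · simpa using h.isFDESol_transport_hat hT (hw₀ T hT)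
  · have hz' := fun T hT => h.isNFDESol_transport_inv hT (hz T hT)
    have hw' := fun T hT => h.isNFDESol_transport_inv hT (hw T hT)
    have hsz := segment_transport h.shift_inv (hz t ht).1 (hz t ht).2.1 (ω := ω) le_rfl
    have hsw := segment_transport h.shift_inv (hw t ht).1 (hw t ht).2.1 (ω := ω) le_rfl
    set z' := transport φ h.inv ω z
    set w' := transport φ h.inv ω w
    have hclose := hzw z' w' hz' hw'
    have happ : ∀ τ, 0 ≤ τ → ∀ s, segment z' τ s - segment w' τ s = z' (τ + s) - w' (τ + s) :=
      fun τ hτ s => by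
        rw [segment_apply_of_continuousOn (hz' τ hτ).1 (hz' τ hτ).2.1 le_rfl,
          segment_apply_of_continuousOn (hw' τ hτ).1 (hw' τ hτ).2.1 le_rfl]
    -- Closeness for `coDist` does not bound the norm. At positive times the endpoint of each
    -- earlier segment gives a difference below `1`; at negative times the initial data lie in the
    -- ball of radius `k'`.
    have hbound : ‖segment z' t - segment w' t‖ ≤ 2 * k' + 1 := by
      refine (BoundedContinuousFunction.norm_le (by positivity)).2 fun s => ?_
      rw [BoundedContinuousFunction.sub_apply, happ t ht]
      have hk0 : (0 : ℝ) ≤ k' := Nat.cast_nonneg k'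
      rcases le_total 0 (t + (s : ℝ)) with h0 | h0
      · have h1 := hε'B _ _ (hclose _ h0) origin (by simp)
        rw [happ _ h0, origin_coe, add_zero] at h1
        linarith [min_le_right B₁ 1]
      · have h1 := (hz' t ht).2.1 ⟨t + s, mem_Iic.2 h0⟩
        have h2 := (hw' t ht).2.1 ⟨t + s, mem_Iic.2 h0⟩
        simp only at h1 h2
        rw [h1, h2]
        refine (norm_sub_le _ _).trans ?_
        linarith [((h.inv ω x).norm_coe_le_norm ⟨t + s, mem_Iic.2 h0⟩).trans (hball ω x hx),
          ((h.inv ω y).norm_coe_le_norm ⟨t + s, mem_Iic.2 h0⟩).trans (hball ω y hy)]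
    refine hNη _ _ fun s hs => ?_
    have h1 := hhat (φ t ω) _ hbound (fun r hr =>
      ((hε'B _ _ (hclose t ht) r hr).trans_le (min_le_left _ _)).le) s hs
    rwa [map_sub, hsz, hsw, hat_inv, hat_inv] at h1

end IsAdmissible

end NeutralFDE

theorem mainTheorem9 {Ω : Type*} [MetricSpace Ω] [CompactSpace Ω]
    (φ : Flow ℝ Ω) (hφ : NeutralFDE.IsMinimalFlow φ)
    (m : ℕ) (a : Fin m → ℝ) (ha : ∀ i, a i < 0)
    (D : Ω → NeutralFDE.BC m →L[ℝ] NeutralFDE.E m)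
    (hD1 : Continuous D)
    (hD2 : NeutralFDE.CompactOpenRegular (fun p : Ω × NeutralFDE.BC m => D p.1 p.2))
    (hD3 : ∀ ω, NeutralFDE.massAtZero (D ω) = 1)
    (hD4 : NeutralFDE.StableOperator φ D)
    (G : Ω × NeutralFDE.BC m → NeutralFDE.E m)
    (hN1 : NeutralFDE.NormRegular G)
    (hN2 : NeutralFDE.CompactOpenRegular G)
    (hN3 : NeutralFDE.NeutralQuasimonotone φ D a G) :
    ∃ Dhat : (Ω × NeutralFDE.BC m) ≃ (Ω × NeutralFDE.BC m),
      (∀ (ω : Ω) (x : NeutralFDE.BC m),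
        (Dhat (ω, x)).1 = ω ∧ ⇑(Dhat (ω, x)).2 = NeutralFDE.dHat₂ φ D ω x) ∧
      NeutralFDE.NormRegular (G ∘ Dhat.symm) ∧
      NeutralFDE.CompactOpenRegular (G ∘ Dhat.symm) ∧
      NeutralFDE.Quasimonotone a (G ∘ Dhat.symm) ∧
      (NeutralFDE.NeutralSeparating φ D a G → NeutralFDE.NeutralBallsStable φ D a G →
        NeutralFDE.Separating φ a (G ∘ Dhat.symm) ∧
        NeutralFDE.BallsStable φ a (G ∘ Dhat.symm)) := by
  have h : NeutralFDE.IsAdmissible φ D := ⟨hD1, hD2, hD3, hD4⟩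
  exact ⟨Equiv.prodShear (Equiv.refl Ω) h.hatEquiv, fun ω x => ⟨rfl, rfl⟩,
    h.normRegular_comp_inv hN1 hN2, h.compactOpenRegular_comp_inv hN2,
    h.quasimonotone_comp_inv hN3,
    fun hN4 hN5 => ⟨h.separating_comp_inv hN4, h.ballsStable_comp_inv hN5⟩⟩
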